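/- Let $k$ be an arbitrary commutative ring with unit, $A$ and $B$ unital associative $k$-algebras, $M$ an $(A,B)$-bimodule on which $k$ acts centrally (that is, a left $A\otimes_k B^{\mathrm{op}}$-module), $E=\begin{pmatrix}A&M\\0&B\end{pmatrix}$ the triangular matrix algebra, and $X$ an $E$-bimodule on which $k$ acts centrally. Put $1_A=\begin{pmatrix}1&0\\0&0\end{pmatrix}$, $1_B=\begin{pmatrix}0&0\\0&1\end{pmatrix}\in E$, and $X_{AA}=1_AX1_A$, $X_{BB}=1_BX1_B$, $X_{AB}=1_AX1_B$, which are an $A$-bimodule, a $B$-bimodule and an $(A,B)$-bimodule respectively. For a $k$-algebra $C$ and a $C$-bimodule $Y$ let $\mathrm H^n(C,Y)$ be Hochschild cohomology over $k$, i.e. the cohomology of the complex of $k$-multilinear maps $C^n\to Y$ with the Hochschild differential. Let $\mathrm{Ext}^n_{A\otimes B^{\mathrm{op}},k}(M,X_{AB})$ be the Ext groups relative to the family of $A\otimes_k B^{\mathrm{op}}$-linear epimorphisms that split as $k$-linear maps, i.e. the cohomology of $\mathrm{Hom}_{A\otimes B^{\mathrm{op}}}(P_*,X_{AB})$, where $P_*\to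 M$ is any projective resolution of $M$ relative to this family. Then there is a long exact sequence of $k$-modules $$0\to \mathrm H^0(E,X)\xrightarrow{j^0}\mathrm H^0(A,X_{AA})\oplus \mathrm H^0(B,X_{BB})\xrightarrow{\delta^0}\mathrm{Ext}^0_{A\otimes B^{\mathrm{op}},k}(M,X_{AB})\xrightarrow{\pi^0}\mathrm H^1(E,X)\xrightarrow{j^1}\cdots$$ $$\cdots\to \mathrm H^n(E,X)\xrightarrow{j^n}\mathrm H^n(A,X_{AA})\oplus \mathrm H^n(B,X_{BB})\xrightarrow{\delta^n}\mathrm{Ext}^n_{A\otimes B^{\mathrm{op}},k}(M,X_{AB})\xrightarrow{\pi^n}\mathrm H^{n+1}(E,X)\xrightarrow{j^{n+1}}\cdots$$ -/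

import Mathlib

open CategoryTheory TensorProduct

set_option linter.unusedSimpArgs false
set_option linter.unusedSectionVars false

universe u v

/-! ### Hochschild cohomology

For a `k`-algebra `C`, a `C`-bimodule over `k` is a `k`-module `Y` with commuting actions of `C` and
`Cᵐᵒᵖ`, both compatible with the `k`-action (`k` acts centrally); `MulOpposite.op c • y` is `y c`. -/

section Hochschild

variable (k : Type u) [CommRing k] (C : Type v) [Ring C] [Algebra k C]
  (Y : Type v) [AddCommGroup Y] [Module k Y] [Module C Y] [Module Cᵐᵒᵖ Y]
  [IsScalarTower k C Y] [IsScalarTower k Cᵐᵒᵖ Y] [SMulCommClass C Cᵐᵒᵖ Y]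

/-- Hochschild `n`-cochains: `k`-multilinear maps `Cⁿ → Y`. -/
abbrev HochschildCochain (n : ℕ) : Type v := MultilinearMap k (fun _ : Fin n => C) Y

variable {C Y}

/-- The `i`-th coface of a function of `n` variables, `0 ≤ i ≤ n + 1`:
`(c₀, …, cₙ)` is sent to `c₀ f(c₁, …, cₙ)` for `i = 0`, to `f(c₀, …, cₙ₋₁) cₙ` for `i = n + 1` and to
`f(c₀, …, cᵢ₋₁ cᵢ, …, cₙ)` otherwise. -/
def hochschildCofaceFun {n : ℕ} (i : ℕ) (f : (Fin n → C) → Y) (c : Fin (n + 1) → C) : Y :=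
  if i = 0 then c 0 • f (fun q => c q.succ)
  else if i = n + 1 then MulOpposite.op (c (Fin.last n)) • f (fun q => c q.castSucc)
  else f (fun q => if (q : ℕ) + 1 < i then c q.castSucc
    else if (q : ℕ) + 1 = i then c q.castSucc * c q.succ else c q.succ)

open Function in
/-- Cofaces of multilinear maps are linear in each variable. -/
theorem exists_linearMap_hochschildCofaceFun_update
  {n : ℕ} (i : ℕ) (f : MultilinearMap k (fun _ : Fin n => C) Y)
  (c : Fin (n + 1) → C) (p : Fin (n + 1)) (hi : i ≤ n + 1) :
  ∃ l : C →ₗ[k] Y, ∀ x, hochschildCofaceFun i f (update c p x) = l x := by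
  unfold hochschildCofaceFun
  split_ifs with h0 h1
  · rcases Fin.eq_zero_or_eq_succ p with rfl | ⟨p', rfl⟩
    · refine ⟨(LinearMap.toSpanSingleton C Y (f (fun q => c q.succ))).restrictScalars k, fun x => ?_⟩
      simp
    · refine ⟨(Module.toModuleEnd k Y (c 0)) ∘ₗ (f.toLinearMap (fun q => c q.succ) p'), fun x => ?_⟩
      simp
      congr 1
      congr 1
      funext q
      simp [Function.update_apply]
  · rcases Fin.eq_castSucc_or_eq_last p with ⟨p', rfl⟩ | rfl
    · refine ⟨(Module.toModuleEnd k Y (MulOpposite.op (c (Fin.last n)))) ∘ₗ (f.toLinearMap (fun q => c q.castSucc) p'), fun x => ?_⟩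
      have : Fin.last n ≠ p'.castSucc := (Fin.castSucc_lt_last p').ne'
      simp [this]
      congr 2
      funext q
      simp [Function.update_apply]
    · refine ⟨((LinearMap.toSpanSingleton Cᵐᵒᵖ Y (f (fun q => c q.castSucc))).restrictScalars k) ∘ₗ (MulOpposite.opLinearEquiv k).toLinearMap, fun x => ?_⟩
      simp [Function.update_apply, Fin.ext_iff]
      congr 2
      funext q
      simp [q.2.ne]
  · set t : Fin n → C := (fun q => if (q : ℕ) + 1 < i then c q.castSucc
    else if (q : ℕ) + 1 = i then c q.castSucc * c q.succ else c q.succ) with ht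
    have key : ∀ (r : Fin n) (l : C →ₗ[k] C),
        (∀ x (q : Fin n), (if (q : ℕ) + 1 < i then update c p x q.castSucc
          else if (q : ℕ) + 1 = i then update c p x q.castSucc * update c p x q.succ
          else update c p x q.succ) = update t r (l x) q) →
        ∃ l : C →ₗ[k] Y, ∀ x, f (fun q : Fin n => if (q : ℕ) + 1 < i then update c p x q.castSucc
          else if (q : ℕ) + 1 = i then update c p x q.castSucc * update c p x q.succ
          else update c p x q.succ) = l x := fun r l h =>
      ⟨f.toLinearMap t r ∘ₗ l, fun x => by
        simp only [LinearMap.comp_apply, MultilinearMap.toLinearMap_apply]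
        exact congrArg f (funext (h x))⟩
    have hpn := p.2
    rcases lt_trichotomy ((p : ℕ) + 1) i with h2 | h2 | h2
    · refine key ⟨p, by omega⟩ LinearMap.id fun x q => ?_
      simp only [Function.update_apply, ht, Fin.ext_iff, Fin.val_castSucc, Fin.val_succ,
        LinearMap.id_apply, LinearMap.mulLeft_apply, LinearMap.mulRight_apply]
      grind
    · refine key ⟨p, by omega⟩ (LinearMap.mulRight k (c ⟨i, by omega⟩)) fun x q => ?_
      simp only [Function.update_apply, ht, Fin.ext_iff, Fin.val_castSucc, Fin.val_succ,
        LinearMap.id_apply, LinearMap.mulLeft_apply, LinearMap.mulRight_apply]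
      grind
    · rcases eq_or_lt_of_le (Nat.le_of_lt_succ h2) with h3 | h3
      · refine key ⟨i - 1, by omega⟩ (LinearMap.mulLeft k (c ⟨i - 1, by omega⟩)) fun x q => ?_
        have e : (q : ℕ) = i - 1 → c ⟨i - 1, by omega⟩ = c q.castSucc :=
          fun h => congrArg c (Fin.ext h.symm)
        simp only [Function.update_apply, ht, Fin.ext_iff, Fin.val_castSucc, Fin.val_succ,
        LinearMap.id_apply, LinearMap.mulLeft_apply, LinearMap.mulRight_apply]
        grind
      · refine key ⟨p - 1, by omega⟩ LinearMap.id fun x q => ?_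
        simp only [Function.update_apply, ht, Fin.ext_iff, Fin.val_castSucc, Fin.val_succ,
        LinearMap.id_apply, LinearMap.mulLeft_apply, LinearMap.mulRight_apply]
        grind

/-- The cosimplicial identities. -/
theorem hochschildCofaceFun_comp
    {n i j : ℕ} (hij : i ≤ j) (hj : j ≤ n + 1) (f : (Fin n → C) → Y) (c : Fin (n + 2) → C) :
    hochschildCofaceFun i (hochschildCofaceFun j f) c =
      hochschildCofaceFun (j + 1) (hochschildCofaceFun i f) c := by
  rcases Nat.eq_zero_or_pos i with rfl | hi
  · rcases Nat.eq_zero_or_pos j with rfl | hj'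
    · simp [hochschildCofaceFun, mul_smul]
    · rcases eq_or_lt_of_le hj with rfl | hj''
      · simp only [hochschildCofaceFun, if_true, Nat.add_eq_zero_iff, one_ne_zero, and_false, if_false]
        exact smul_comm _ _ _
      · have h1 : j ≠ 0 := by omega
        have h2 : j ≠ n + 1 := by omega
        simp [hochschildCofaceFun, h1, h2]
  · rcases eq_or_lt_of_le hj with rfl | hj'
    · rcases eq_or_lt_of_le hij with rfl | hij'
      · simp [hochschildCofaceFun, mul_smul]
      · have h1 : i ≠ 0 := by omega
        have h2 : i ≠ n + 1 := by omega
        have h3 : i ≠ n + 2 := by omega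
        simp [hochschildCofaceFun, h1, h2, h3]
        rw [if_neg (by omega), if_neg (by omega)]
    · have h1 : i ≠ 0 := by omega
      have h2 : i ≠ n + 1 := by omega
      have h3 : i ≠ n + 2 := by omega
      have h4 : j ≠ 0 := by omega
      have h5 : j ≠ n + 1 := by omega
      simp only [hochschildCofaceFun, h1, h2, h3, h4, h5, if_false, Nat.add_right_cancel_iff,
        Nat.add_eq_zero_iff, one_ne_zero, and_false]
      congr 1
      funext q
      simp only [Fin.val_castSucc, Fin.val_succ, ← Fin.succ_castSucc]
      grind [mul_assoc]

variable (C Y)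

/-- The `i`-th coface map on Hochschild cochains. -/
def hochschildCoface (n : ℕ) (i : Fin (n + 2)) :
    HochschildCochain k C Y n →ₗ[k] HochschildCochain k C Y (n + 1) where
  toFun f :=
    { toFun := hochschildCofaceFun i f
      map_update_add' := fun {dec} c p x y => by
        obtain rfl : dec = instDecidableEqFin _ := Subsingleton.elim _ _
        obtain ⟨l, hl⟩ := exists_linearMap_hochschildCofaceFun_update k i f c p (by omega)
        rw [hl, hl, hl, map_add]
      map_update_smul' := fun {dec} c p r x => by
        obtain rfl : dec = instDecidableEqFin _ := Subsingleton.elim _ _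
        obtain ⟨l, hl⟩ := exists_linearMap_hochschildCofaceFun_update k i f c p (by omega)
        rw [hl, hl, map_smul] }
  map_add' f g := by
    ext c
    simp only [hochschildCofaceFun, MultilinearMap.coe_mk, add_apply]
    split_ifs <;> simp
  map_smul' r f := by
    ext c
    simp only [hochschildCofaceFun, MultilinearMap.coe_mk, smul_apply,
      RingHom.id_apply]
    split_ifs
    · exact smul_comm _ _ _
    · exact smul_comm _ _ _
    · rfl

/-- The Hochschild differential
`(d f)(c₀, …, cₙ) = c₀ f(c₁, …, cₙ) + ∑_{1 ≤ i ≤ n} (-1)ⁱ f(c₀, …, cᵢ₋₁ cᵢ, …, cₙ)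
  + (-1)ⁿ⁺¹ f(c₀, …, cₙ₋₁) cₙ`. -/
def hochschildD (n : ℕ) : HochschildCochain k C Y n →ₗ[k] HochschildCochain k C Y (n + 1) :=
  ∑ i : Fin (n + 2), (-1 : ℤ) ^ (i : ℕ) • hochschildCoface k C Y n i

theorem hochschildD_comp (n : ℕ) : hochschildD k C Y (n + 1) ∘ₗ hochschildD k C Y n = 0 := by
  have hcomp : ∀ (i : Fin (n + 3)) (j : Fin (n + 2)) (h : (i : ℕ) ≤ j),
      hochschildCoface k C Y (n + 1) i ∘ₗ hochschildCoface k C Y n j =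
        hochschildCoface k C Y (n + 1) j.succ ∘ₗ
          hochschildCoface k C Y n ⟨i, by omega⟩ := by
    intro i j h
    ext f c
    exact hochschildCofaceFun_comp h (by omega) f c
  have hexp : hochschildD k C Y (n + 1) ∘ₗ hochschildD k C Y n =
      ∑ p : Fin (n + 3) × Fin (n + 2), (-1 : ℤ) ^ ((p.1 : ℕ) + (p.2 : ℕ)) •
        (hochschildCoface k C Y (n + 1) p.1 ∘ₗ hochschildCoface k C Y n p.2) := by
    refine LinearMap.ext fun f => ?_
    simp only [hochschildD, LinearMap.comp_apply, LinearMap.sum_apply, LinearMap.smul_apply,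
      map_sum, map_zsmul, Fintype.sum_prod_type, smul_smul, pow_add, Finset.smul_sum]
    rw [Finset.sum_comm]
    simp only [mul_comm]
  rw [hexp, ← Finset.sum_filter_add_sum_filter_not _ (fun p => (p.1 : ℕ) ≤ (p.2 : ℕ)),
    ← eq_neg_iff_add_eq_zero, ← Finset.sum_neg_distrib]
  refine Finset.sum_bij' (fun p _ => (p.2.succ, ⟨min p.1 (n + 1), by omega⟩))
    (fun p _ => (p.2.castSucc, ⟨p.1 - 1, by omega⟩)) ?_ ?_ ?_ ?_ ?_
  · rintro ⟨i, j⟩ h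
    simp only [Finset.mem_filter, Finset.mem_univ, true_and, Fin.val_succ] at h ⊢
    omega
  · rintro ⟨i, j⟩ h
    simp only [Finset.mem_filter, Finset.mem_univ, true_and, Fin.val_castSucc] at h ⊢
    omega
  · rintro ⟨i, j⟩ h
    simp only [Finset.mem_filter, Finset.mem_univ, true_and] at h
    simp only [Prod.mk.injEq, Fin.ext_iff, Fin.val_castSucc, Fin.val_succ]
    omega
  · rintro ⟨i, j⟩ h
    simp only [Finset.mem_filter, Finset.mem_univ, true_and] at h
    simp only [Prod.mk.injEq, Fin.ext_iff, Fin.val_castSucc, Fin.val_succ]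
    omega
  · rintro ⟨i, j⟩ h
    simp only [Finset.mem_filter, Finset.mem_univ, true_and] at h
    have hm : (⟨min (i : ℕ) (n + 1), by omega⟩ : Fin (n + 2)) = ⟨i, by omega⟩ := by
      ext; simp only; omega
    simp only [hm]
    rw [hcomp i j h, ← neg_smul]
    congr 1
    have hm' : min (i : ℕ) (n + 1) = i := by omega
    rw [hm', Fin.val_succ, pow_add, pow_add, pow_succ]
    ring

/-- The Hochschild cochain complex of `C` with coefficients in the bimodule `Y`. -/
noncomputable def hochschildComplex : CochainComplex (ModuleCat.{v} k) ℕ :=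
  CochainComplex.of (fun n => ModuleCat.of k (HochschildCochain k C Y n))
    (fun n => ModuleCat.ofHom (hochschildD k C Y n))
    (fun n => by rw [← ModuleCat.ofHom_comp, hochschildD_comp]; rfl)

/-- Hochschild cohomology `Hⁿ(C, Y)`. -/
noncomputable abbrev hochschildCohomology (n : ℕ) : ModuleCat.{v} k :=
  (hochschildComplex k C Y).homology n

end Hochschild

/-! ### Relative `Ext`

Let `R` be a `k`-algebra. An `R`-module is always regarded as a `k`-module through `k → R`
(this is what `IsScalarTower k R P` says). -/

section RelativeExt

variable (k : Type u) [CommRing k] (R : Type v) [Ring R] [Algebra k R]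

/-- `P` is projective relative to the `R`-linear epimorphisms that split as `k`-linear maps. -/
def IsRelProjective (P : Type v) [AddCommGroup P] [Module R P] : Prop :=
  ∀ (Y Z : Type v) [AddCommGroup Y] [Module k Y] [Module R Y] [IsScalarTower k R Y]
    [AddCommGroup Z] [Module k Z] [Module R Z] [IsScalarTower k R Z]
    (g : Y →ₗ[R] Z) (s : Z →ₗ[k] Y), (∀ z, g (s z) = z) →
    ∀ f : P →ₗ[R] Z, ∃ f' : P →ₗ[R] Y, g ∘ₗ f' = f

/-- A projective resolution `⋯ → X 1 → X 0 → N → 0` of `N` relative to the `R`-linear epimorphisms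
that split over `k`: all `X n` are relatively projective, consecutive maps compose to zero, and
the maps `X 0 → N`, `X 1 → ker π` and `X (n + 2) → ker (d n)` are epimorphisms that split over `k`. -/
structure RelProjResolution (N : Type v) [AddCommGroup N] [Module k N] [Module R N]
    [IsScalarTower k R N] where
  X : ℕ → Type v
  [addCommGroup : ∀ n, AddCommGroup (X n)]
  [moduleBase : ∀ n, Module k (X n)]
  [module : ∀ n, Module R (X n)]
  [isScalarTower : ∀ n, IsScalarTower k R (X n)]
  π : X 0 →ₗ[R] N
  d : ∀ n, X (n + 1) →ₗ[R] X n
  projective : ∀ n, IsRelProjective k R (X n)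
  π_comp_d : π ∘ₗ d 0 = 0
  d_comp_d : ∀ n, d n ∘ₗ d (n + 1) = 0
  split_π : ∃ s : N →ₗ[k] X 0, ∀ x, π (s x) = x
  split_zero : ∃ s : LinearMap.ker π →ₗ[k] X 1, ∀ z, d 0 (s z) = z
  split_succ : ∀ n, ∃ s : LinearMap.ker (d n) →ₗ[k] X (n + 2), ∀ z, d (n + 1) (s z) = z

attribute [instance] RelProjResolution.addCommGroup RelProjResolution.moduleBase
  RelProjResolution.module RelProjResolution.isScalarTower

variable {k R}

/-- The cochain complex `Hom_R(X_*, Y)` of `k`-modules. -/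
noncomputable def RelProjResolution.homComplex {N : Type v} [AddCommGroup N] [Module k N]
    [Module R N] [IsScalarTower k R N] (P : RelProjResolution k R N)
    (Y : Type v) [AddCommGroup Y] [Module k Y] [Module R Y] [IsScalarTower k R Y] :
    CochainComplex (ModuleCat.{v} k) ℕ :=
  CochainComplex.of (fun n => ModuleCat.of k (P.X n →ₗ[R] Y))
    (fun n => ModuleCat.ofHom (LinearMap.lcomp k Y (P.d n)))
    (fun n => by
      ext f x
      exact (congrArg f (LinearMap.congr_fun (P.d_comp_d n) x)).trans (map_zero f))

/-- The relative `Ext` group `Extⁿ_{R,k}(N, Y)`, computed by the relative projective resolution `P`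
of `N`. -/
noncomputable abbrev RelProjResolution.ext {N : Type v} [AddCommGroup N] [Module k N]
    [Module R N] [IsScalarTower k R N] (P : RelProjResolution k R N)
    (Y : Type v) [AddCommGroup Y] [Module k Y] [Module R Y] [IsScalarTower k R Y] (n : ℕ) :
    ModuleCat.{v} k :=
  (P.homComplex Y).homology n

end RelativeExt

section Existence

variable (k : Type u) [CommRing k] (R : Type v) [Ring R] [Algebra k R]

/-- Bundled `R`-modules with their `k`-action. -/
structure RelModule where
  carrier : Type v
  [addCommGroup : AddCommGroup carrier]
  [moduleBase : Module k carrier]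
  [module : Module R carrier]
  [isScalarTower : IsScalarTower k R carrier]

attribute [instance] RelModule.addCommGroup RelModule.moduleBase RelModule.module
  RelModule.isScalarTower

variable {k R}

/-- The action map `R ⊗ N → N`. -/
noncomputable def RelModule.act (N : RelModule.{u, v} k R) : R ⊗[k] N.carrier →ₗ[R] N.carrier :=
  TensorProduct.AlgebraTensorModule.lift
    (LinearMap.toSpanSingleton R (N.carrier →ₗ[k] N.carrier) LinearMap.id)

theorem RelModule.act_one_tmul (N : RelModule.{u, v} k R) (x : N.carrier) :
    N.act (1 ⊗ₜ[k] x) = x := by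
  simp [RelModule.act]

/-- Iterated kernels of the action maps, starting from `N`. -/
noncomputable def RelModule.syzygy (N : RelModule.{u, v} k R) : ℕ → RelModule.{u, v} k R
  | 0 => N
  | n + 1 => ⟨LinearMap.ker (RelModule.syzygy N n).act⟩

theorem isRelProjective_tensorProduct (N : Type v) [AddCommGroup N] [Module k N] :
    IsRelProjective k R (R ⊗[k] N) := by
  intro Y Z _ _ _ _ _ _ _ _ g s hs f
  refine ⟨TensorProduct.AlgebraTensorModule.lift (LinearMap.toSpanSingleton R (N →ₗ[k] Y)
    (s ∘ₗ (f.restrictScalars k) ∘ₗ TensorProduct.mk k R N 1)), ?_⟩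
  ext x
  simp [hs]

/-- Relative projective resolutions exist, so that relative `Ext` groups are available for every
module. -/
theorem RelProjResolution.nonempty (N : Type v) [AddCommGroup N] [Module k N] [Module R N]
    [IsScalarTower k R N] : Nonempty (RelProjResolution k R N) := by
  let S : ℕ → RelModule.{u, v} k R := RelModule.syzygy ⟨N⟩
  have hker : ∀ n, LinearMap.ker ((LinearMap.ker (S n).act).subtype ∘ₗ (S (n + 1)).act) =
      LinearMap.ker (S (n + 1)).act := fun n =>
    LinearMap.ker_comp_of_ker_eq_bot _ (Submodule.ker_subtype _)
  refine ⟨{ X := fun n => R ⊗[k] (S n).carrier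
            π := (S 0).act
            d := fun n => (LinearMap.ker (S n).act).subtype ∘ₗ (S (n + 1)).act
            projective := fun n => isRelProjective_tensorProduct _
            π_comp_d := ?_
            d_comp_d := ?_
            split_π := ⟨TensorProduct.mk k R N 1, fun x => (S 0).act_one_tmul x⟩
            split_zero := ⟨TensorProduct.mk k R (S 1).carrier 1, fun z => ?_⟩
            split_succ := fun n => ⟨TensorProduct.mk k R (S (n + 2)).carrier 1 ∘ₗ
              ((LinearEquiv.ofEq _ _ (hker n)).restrictScalars k).toLinearMap, fun z => ?_⟩ }⟩
  · refine LinearMap.ext fun x => ?_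
    exact ((S 1).act x).2
  · refine fun n => LinearMap.ext fun x => ?_
    exact congrArg Subtype.val ((S (n + 2)).act x).2
  · exact congrArg Subtype.val ((S 1).act_one_tmul z)
  · exact congrArg Subtype.val ((S (n + 2)).act_one_tmul _)

end Existence

/-! ### The triangular algebra -/

/-- Matrices `(a m; 0 b)` with `a ∈ A`, `m ∈ M`, `b ∈ B`. -/
@[ext]
structure TriangularAlgebra (A M B : Type v) : Type v where
  a : A
  m : M
  b : B

namespace TriangularAlgebra

section Ring

variable {k : Type u} {A M B : Type v} [CommRing k] [Ring A] [Ring B] [AddCommGroup M]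

instance : Zero (TriangularAlgebra A M B) := ⟨⟨0, 0, 0⟩⟩
instance : One (TriangularAlgebra A M B) := ⟨⟨1, 0, 1⟩⟩
instance : Add (TriangularAlgebra A M B) := ⟨fun x y => ⟨x.a + y.a, x.m + y.m, x.b + y.b⟩⟩
instance : Neg (TriangularAlgebra A M B) := ⟨fun x => ⟨-x.a, -x.m, -x.b⟩⟩

instance [Module A M] [Module Bᵐᵒᵖ M] : Mul (TriangularAlgebra A M B) :=
  ⟨fun x y => ⟨x.a * y.a, x.a • y.m + MulOpposite.op y.b • x.m, x.b * y.b⟩⟩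

instance [Algebra k A] [Algebra k B] [Module k M] : SMul k (TriangularAlgebra A M B) :=
  ⟨fun r x => ⟨r • x.a, r • x.m, r • x.b⟩⟩

@[simp] theorem zero_a : (0 : TriangularAlgebra A M B).a = 0 := rfl
@[simp] theorem zero_m : (0 : TriangularAlgebra A M B).m = 0 := rfl
@[simp] theorem zero_b : (0 : TriangularAlgebra A M B).b = 0 := rfl
@[simp] theorem one_a : (1 : TriangularAlgebra A M B).a = 1 := rfl
@[simp] theorem one_m : (1 : TriangularAlgebra A M B).m = 0 := rfl
@[simp] theorem one_b : (1 : TriangularAlgebra A M B).b = 1 := rfl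
@[simp] theorem add_a (x y : TriangularAlgebra A M B) : (x + y).a = x.a + y.a := rfl
@[simp] theorem add_m (x y : TriangularAlgebra A M B) : (x + y).m = x.m + y.m := rfl
@[simp] theorem add_b (x y : TriangularAlgebra A M B) : (x + y).b = x.b + y.b := rfl
@[simp] theorem neg_a (x : TriangularAlgebra A M B) : (-x).a = -x.a := rfl
@[simp] theorem neg_m (x : TriangularAlgebra A M B) : (-x).m = -x.m := rfl
@[simp] theorem neg_b (x : TriangularAlgebra A M B) : (-x).b = -x.b := rfl
@[simp] theorem mul_a [Module A M] [Module Bᵐᵒᵖ M] (x y : TriangularAlgebra A M B) :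
    (x * y).a = x.a * y.a := rfl
@[simp] theorem mul_m [Module A M] [Module Bᵐᵒᵖ M] (x y : TriangularAlgebra A M B) :
    (x * y).m = x.a • y.m + MulOpposite.op y.b • x.m := rfl
@[simp] theorem mul_b [Module A M] [Module Bᵐᵒᵖ M] (x y : TriangularAlgebra A M B) :
    (x * y).b = x.b * y.b := rfl
@[simp] theorem smul_a [Algebra k A] [Algebra k B] [Module k M] (r : k)
    (x : TriangularAlgebra A M B) : (r • x).a = r • x.a := rfl
@[simp] theorem smul_m [Algebra k A] [Algebra k B] [Module k M] (r : k)
    (x : TriangularAlgebra A M B) : (r • x).m = r • x.m := rfl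
@[simp] theorem smul_b [Algebra k A] [Algebra k B] [Module k M] (r : k)
    (x : TriangularAlgebra A M B) : (r • x).b = r • x.b := rfl

instance [Module A M] [Module Bᵐᵒᵖ M] [SMulCommClass A Bᵐᵒᵖ M] :
    Ring (TriangularAlgebra A M B) where
  add_assoc x y z := by ext <;> simp [add_assoc]
  zero_add x := by ext <;> simp
  add_zero x := by ext <;> simp
  add_comm x y := by ext <;> simp [add_comm]
  neg_add_cancel x := by ext <;> simp
  nsmul := nsmulRec
  zsmul := zsmulRec
  left_distrib x y z := by ext <;> simp [mul_add, add_smul]; abel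
  right_distrib x y z := by ext <;> simp [add_mul, add_smul]; abel
  zero_mul x := by ext <;> simp
  mul_zero x := by ext <;> simp
  mul_assoc x y z := by
    ext <;> simp [mul_assoc, mul_smul, add_assoc, smul_comm x.a (MulOpposite.op z.b) y.m]
  one_mul x := by ext <;> simp
  mul_one x := by ext <;> simp

variable [Algebra k A] [Algebra k B] [Module k M] [Module A M] [Module Bᵐᵒᵖ M]
  [SMulCommClass A Bᵐᵒᵖ M]

instance : Module k (TriangularAlgebra A M B) where
  one_smul x := by ext <;> simp
  mul_smul r s x := by ext <;> simp [mul_smul]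
  smul_zero r := by ext <;> simp
  smul_add r x y := by ext <;> simp
  add_smul r s x := by ext <;> simp [add_smul]
  zero_smul x := by ext <;> simp

variable [IsScalarTower k A M] [IsScalarTower k Bᵐᵒᵖ M]

instance : Algebra k (TriangularAlgebra A M B) :=
  Algebra.ofModule
    (fun r x y => by
      ext <;> simp [smul_comm r (MulOpposite.op y.b) x.m])
    (fun r x y => by
      ext <;> simp [smul_comm x.a r y.m])

variable (k A M B)

/-- The inclusion `a ↦ (a 0; 0 0)`, which is multiplicative but does not preserve the unit. -/
def inA : A →ₙₐ[k] TriangularAlgebra A M B where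
  toFun a := ⟨a, 0, 0⟩
  map_smul' r x := by ext <;> simp
  map_zero' := rfl
  map_add' x y := by ext <;> simp
  map_mul' x y := by ext <;> simp

/-- The inclusion `b ↦ (0 0; 0 b)`, which is multiplicative but does not preserve the unit. -/
def inB : B →ₙₐ[k] TriangularAlgebra A M B where
  toFun b := ⟨0, 0, b⟩
  map_smul' r x := by ext <;> simp
  map_zero' := rfl
  map_add' x y := by ext <;> simp
  map_mul' x y := by ext <;> simp

end Ring

end TriangularAlgebra

/-! ### Corners of a bimodule -/

section Corner

variable {k : Type u} [CommRing k] {A B E : Type v} [Ring A] [Algebra k A] [Ring B] [Algebra k B]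
  [Ring E] [Algebra k E] (φ : A →ₙₐ[k] E) (ψ : B →ₙₐ[k] E)
  (X : Type v) [AddCommGroup X] [Module k X] [Module E X] [Module Eᵐᵒᵖ X]
  [IsScalarTower k E X] [IsScalarTower k Eᵐᵒᵖ X] [SMulCommClass E Eᵐᵒᵖ X]

/-- For multiplicative `k`-linear maps `φ : A → E` and `ψ : B → E`, not necessarily preserving units,
the corner `φ(1) X ψ(1)` of an `E`-bimodule `X`. -/
def corner : Submodule k X where
  carrier := {y | ∃ x : X, φ 1 • MulOpposite.op (ψ 1) • x = y}
  zero_mem' := ⟨0, by simp⟩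
  add_mem' := by
    rintro _ _ ⟨x, rfl⟩ ⟨y, rfl⟩
    exact ⟨x + y, by simp⟩
  smul_mem' := by
    rintro r _ ⟨x, rfl⟩
    exact ⟨r • x, by rw [smul_comm (MulOpposite.op (ψ 1)) r x, smul_comm (φ 1) r]⟩

variable {X}

theorem smul_mem_corner (a : A) {y : X} (hy : y ∈ corner φ ψ X) : φ a • y ∈ corner φ ψ X := by
  obtain ⟨x, rfl⟩ := hy
  refine ⟨φ a • x, ?_⟩
  rw [← smul_comm (φ a), ← mul_smul, ← mul_smul, ← map_mul, ← map_mul, one_mul, mul_one]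

theorem op_smul_mem_corner (b : B) {y : X} (hy : y ∈ corner φ ψ X) :
    MulOpposite.op (ψ b) • y ∈ corner φ ψ X := by
  obtain ⟨x, rfl⟩ := hy
  refine ⟨MulOpposite.op (ψ b) • x, ?_⟩
  rw [← smul_comm (φ 1), ← mul_smul, ← mul_smul, ← MulOpposite.op_mul, ← MulOpposite.op_mul,
    ← map_mul, ← map_mul, one_mul, mul_one]

theorem one_smul_corner {y : X} (hy : y ∈ corner φ ψ X) : φ 1 • y = y := by
  obtain ⟨x, rfl⟩ := hy
  rw [← mul_smul, ← map_mul, one_mul]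

theorem op_one_smul_corner {y : X} (hy : y ∈ corner φ ψ X) : MulOpposite.op (ψ 1) • y = y := by
  obtain ⟨x, rfl⟩ := hy
  rw [← smul_comm (φ 1), ← mul_smul, ← MulOpposite.op_mul, ← map_mul, one_mul]

variable (X)

/-- `A` acts on `φ(1) X ψ(1)` on the left through `φ`. -/
instance cornerModule : Module A (corner φ ψ X) where
  smul a y := ⟨φ a • (y : X), smul_mem_corner φ ψ a y.2⟩
  one_smul y := Subtype.ext (one_smul_corner φ ψ y.2)
  mul_smul a b y := Subtype.ext (by
    change φ (a * b) • (y : X) = φ a • φ b • (y : X)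
    rw [map_mul, mul_smul])
  smul_zero a := Subtype.ext (smul_zero (φ a))
  smul_add a y z := Subtype.ext (smul_add (φ a) (y : X) (z : X))
  add_smul a b y := Subtype.ext (by
    change φ (a + b) • (y : X) = φ a • (y : X) + φ b • (y : X)
    rw [map_add, add_smul])
  zero_smul y := Subtype.ext (by
    change φ 0 • (y : X) = 0
    rw [map_zero, zero_smul])

/-- `B` acts on `φ(1) X ψ(1)` on the right through `ψ`. -/
instance cornerModuleOp : Module Bᵐᵒᵖ (corner φ ψ X) where
  smul b y := ⟨MulOpposite.op (ψ b.unop) • (y : X), op_smul_mem_corner φ ψ b.unop y.2⟩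
  one_smul y := Subtype.ext (op_one_smul_corner φ ψ y.2)
  mul_smul a b y := Subtype.ext (by
    change MulOpposite.op (ψ (b.unop * a.unop)) • (y : X) =
      MulOpposite.op (ψ a.unop) • MulOpposite.op (ψ b.unop) • (y : X)
    rw [map_mul, MulOpposite.op_mul, mul_smul])
  smul_zero b := Subtype.ext (smul_zero (MulOpposite.op (ψ b.unop)))
  smul_add b y z := Subtype.ext (smul_add (MulOpposite.op (ψ b.unop)) (y : X) (z : X))
  add_smul a b y := Subtype.ext (by
    change MulOpposite.op (ψ (a.unop + b.unop)) • (y : X) =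
      MulOpposite.op (ψ a.unop) • (y : X) + MulOpposite.op (ψ b.unop) • (y : X)
    rw [map_add, MulOpposite.op_add, add_smul])
  zero_smul y := Subtype.ext (by
    change MulOpposite.op (ψ 0) • (y : X) = 0
    rw [map_zero, MulOpposite.op_zero, zero_smul])

instance cornerIsScalarTower : IsScalarTower k A (corner φ ψ X) where
  smul_assoc r a y := Subtype.ext (by
    change φ (r • a) • (y : X) = r • φ a • (y : X)
    rw [map_smul, smul_assoc])

instance cornerIsScalarTowerOp : IsScalarTower k Bᵐᵒᵖ (corner φ ψ X) where
  smul_assoc r b y := Subtype.ext (by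
    change MulOpposite.op (ψ (r • b.unop)) • (y : X) = r • MulOpposite.op (ψ b.unop) • (y : X)
    rw [map_smul, MulOpposite.op_smul, smul_assoc])

instance cornerSMulCommClass : SMulCommClass A Bᵐᵒᵖ (corner φ ψ X) where
  smul_comm a b y := Subtype.ext (smul_comm (φ a) (MulOpposite.op (ψ b.unop)) (y : X))

end Corner

namespace TriangularAlgebra

variable (k : Type u) (A M B : Type v) [CommRing k] [Ring A] [Algebra k A] [Ring B] [Algebra k B]
  [AddCommGroup M] [Module k M] [Module A M] [Module Bᵐᵒᵖ M]
  [IsScalarTower k A M] [IsScalarTower k Bᵐᵒᵖ M] [SMulCommClass A Bᵐᵒᵖ M]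
  (X : Type v) [AddCommGroup X] [Module k X]
  [Module (TriangularAlgebra A M B) X] [Module (TriangularAlgebra A M B)ᵐᵒᵖ X]
  [IsScalarTower k (TriangularAlgebra A M B) X] [IsScalarTower k (TriangularAlgebra A M B)ᵐᵒᵖ X]
  [SMulCommClass (TriangularAlgebra A M B) (TriangularAlgebra A M B)ᵐᵒᵖ X]

/-- The `A`-bimodule `X_AA = 1_A X 1_A`. -/
abbrev XAA : Submodule k X := corner (inA k A M B) (inA k A M B) X

/-- The `(A, B)`-bimodule `X_AB = 1_A X 1_B`. -/
abbrev XAB : Submodule k X := corner (inA k A M B) (inB k A M B) X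

/-- The `B`-bimodule `X_BB = 1_B X 1_B`. -/
abbrev XBB : Submodule k X := corner (inB k A M B) (inB k A M B) X

end TriangularAlgebra

/-! ### Relative `Ext` of bimodules -/

section BimoduleExt

variable (k : Type u) (A B : Type v) [CommRing k] [Ring A] [Algebra k A] [Ring B] [Algebra k B]
  (M : Type v) [AddCommGroup M] [Module k M] [Module A M] [Module Bᵐᵒᵖ M]
  [IsScalarTower k A M] [IsScalarTower k Bᵐᵒᵖ M] [SMulCommClass A Bᵐᵒᵖ M]
  (Y : Type v) [AddCommGroup Y] [Module k Y] [Module A Y] [Module Bᵐᵒᵖ Y]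
  [IsScalarTower k A Y] [IsScalarTower k Bᵐᵒᵖ Y] [SMulCommClass A Bᵐᵒᵖ Y]

attribute [local instance] TensorProduct.Algebra.module

theorem isScalarTower_tensorProduct_op : IsScalarTower k (A ⊗[k] Bᵐᵒᵖ) M where
  smul_assoc r t m := by
    change TensorProduct.Algebra.moduleAux (r • t) m = r • TensorProduct.Algebra.moduleAux t m
    rw [map_smul, LinearMap.smul_apply]

attribute [local instance] isScalarTower_tensorProduct_op

/-- Projective resolutions of the `(A, B)`-bimodule `M`, regarded as a left `A ⊗ Bᵒᵖ`-module by
`(a ⊗ b) m = a m b`, relative to the `A ⊗ Bᵒᵖ`-linear epimorphisms that split over `k`. -/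
abbrev BimoduleResolution := RelProjResolution k (A ⊗[k] Bᵐᵒᵖ) M

variable {k A B M}

/-- `Extⁿ_{A ⊗ Bᵒᵖ, k}(M, Y)` for an `(A, B)`-bimodule `Y`, computed by the relative projective
resolution `P` of `M`. -/
noncomputable abbrev bimoduleExt (P : BimoduleResolution k A B M) (n : ℕ) : ModuleCat.{v} k :=
  P.ext Y n

end BimoduleExt

/-! ### Complexes of modules -/

section Complexes

variable {k : Type u} [CommRing k]

/-! Restrict a Hochschild cochain of E to the arguments in A, respectively B, and cut its values
down to the diagonal corners. This is a chain map onto the product of the cochain complexes of (A,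
X_AA) and (B, X_BB); extension by zero splits it in each degree. Its kernel is the off-diagonal
complex K(X). The long exact sequence of this restriction is the desired one as soon as H⁰(K(X)) = 0
and Hⁿ⁺¹(K(X)) ≅ Extⁿ(M, X_AB).

Low degrees are direct. A 0-cocycle of K(X) is a central element with zero diagonal corners, hence
0. A 1-cocycle is a derivation; modulo an inner derivation it kills 1_A and 1_B, and what is left of
it is a bimodule map M → X_AB (`homToOffDiagHomology_bijective`).

Higher degrees follow by dimension shifting in X. Embed X, by z ↦ ((x, y) ↦ x z y), in the bimodule
I of k-bilinear maps E × E → X, with cokernel Z. Evaluation at (1, 1) splits the embedding over k,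
so both K(-) and the relative Hom complex into the AB corner turn 0 → X → I → Z → 0 into a short
exact sequence of complexes. Both theories vanish on I in the required degrees, and triangularity is
the reason: E 1_A = A and 1_B E = B, so I_AA is coinduced in its left variable, I_BB in its right
variable and I_AB in both, while I is coinduced over E. The first shift compares two copies of the
cokernel of Hom(M, I_AB) → Hom(M, Z_AB); every later shift is a connecting isomorphism on each side
(`nonempty_homology_offDiagComplex_equiv`).

Nothing has to be projective or flat over k, since all sequences of coefficients split over k. The
isomorphisms need not be natural either: the claim is that some exact sequence with these terms
exists, and any isomorphisms can be used to transport it. -/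

theorem ModuleCat.isZero_iff_forall_eq_zero (N : ModuleCat.{v} k) :
    Limits.IsZero N ↔ ∀ x : N, x = 0 := by
  rw [ModuleCat.isZero_iff_subsingleton]
  exact ⟨fun _ x => Subsingleton.elim x 0, fun h => ⟨fun x y => (h x).trans (h y).symm⟩⟩

/-! ### Cohomology as cocycles modulo coboundaries -/

namespace HomologicalComplex

variable {ι : Type*} {c : ComplexShape ι} (K : HomologicalComplex (ModuleCat.{v} k) c)

theorem homologyπ_surjective (n : ι) : Function.Surjective (K.homologyπ n) :=
  (ModuleCat.epi_iff_surjective _).1 inferInstance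

theorem iCycles_injective (n : ι) : Function.Injective (K.iCycles n) :=
  (ModuleCat.mono_iff_injective _).1 inferInstance

theorem d_iCycles_apply (n m : ι) (z : K.cycles n) : K.d n m (K.iCycles n z) = 0 :=
  ConcreteCategory.congr_hom (K.iCycles_d n m) z

theorem toCycles_i_apply (i j : ι) (y : K.X i) : K.iCycles j (K.toCycles i j y) = K.d i j y :=
  ConcreteCategory.congr_hom (K.toCycles_i i j) y

/-- Cohomology is the cokernel of the map from cochains to cocycles, so a class vanishes exactly on
the image of that map. -/
theorem homologyπ_eq_zero_iff {i n : ι} (hi : c.prev n = i) (z : K.cycles n) :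
    K.homologyπ n z = 0 ↔ ∃ y : K.X i, K.d i n y = K.iCycles n z := by
  have h := (ShortComplex.moduleCat_exact_iff _).1
    (ShortComplex.exact_of_g_is_cokernel
      (ShortComplex.mk _ _ (K.toCycles_comp_homologyπ i n)) (K.homologyIsCokernel i n hi))
  constructor
  · intro hz
    obtain ⟨y, hy⟩ := h z hz
    exact ⟨y, by rw [← K.toCycles_i_apply]; exact congrArg _ hy⟩
  · rintro ⟨y, hy⟩
    obtain rfl : K.toCycles i n y = z := K.iCycles_injective n ((K.toCycles_i_apply i n y).trans hy)
    exact ConcreteCategory.congr_hom (K.toCycles_comp_homologyπ i n) y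

/-- The map to cohomology induced by a map to the cocycles. -/
noncomputable def cocycleClass {N : ModuleCat.{v} k} {n m : ι} (hm : c.next n = m) (φ : N ⟶ K.X n)
    (hφ : φ ≫ K.d n m = 0) : N ⟶ K.homology n :=
  K.liftCycles φ m hm hφ ≫ K.homologyπ n

theorem cocycleClass_comp_homologyMap {K L : HomologicalComplex (ModuleCat.{v} k) c}
    {N N' : ModuleCat.{v} k} {n m : ι} (hm : c.next n = m)
    (φ : N ⟶ K.X n) (hφ : φ ≫ K.d n m = 0) (φ' : N' ⟶ L.X n) (hφ' : φ' ≫ L.d n m = 0)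
    (f : K ⟶ L) (q : N ⟶ N') (h : φ ≫ f.f n = q ≫ φ') :
    K.cocycleClass hm φ hφ ≫ homologyMap f n = q ≫ L.cocycleClass hm φ' hφ' := by
  simp only [cocycleClass, Category.assoc, homologyπ_naturality, liftCycles_comp_cyclesMap_assoc,
    comp_liftCycles_assoc, h]

theorem liftCycles_i_apply {N : ModuleCat.{v} k} {n m : ι} (hm : c.next n = m) (φ : N ⟶ K.X n)
    (hφ : φ ≫ K.d n m = 0) (x : N) : K.iCycles n (K.liftCycles φ m hm hφ x) = φ x :=
  ConcreteCategory.congr_hom (K.liftCycles_i φ m hm hφ) x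

/-- A criterion for a family of explicit cocycles to represent every class exactly once: no nonzero
member is a coboundary, and each cocycle is cohomologous to a member. -/
theorem cocycleClass_bijective {N : ModuleCat.{v} k} {i n m : ι} (hi : c.prev n = i)
    (hm : c.next n = m) (φ : N ⟶ K.X n) (hφ : φ ≫ K.d n m = 0)
    (hinj : ∀ (x : N) (y : K.X i), K.d i n y = φ x → x = 0)
    (hsurj : ∀ z : K.X n, K.d n m z = 0 → ∃ (x : N) (y : K.X i), K.d i n y = z - φ x) :
    Function.Bijective (K.cocycleClass hm φ hφ) := by
  constructor
  · rw [injective_iff_map_eq_zero]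
    intro x hx
    obtain ⟨y, hy⟩ := (K.homologyπ_eq_zero_iff hi _).1 hx
    exact hinj x y (hy.trans (K.liftCycles_i_apply hm φ hφ x))
  · intro w
    obtain ⟨z, rfl⟩ := K.homologyπ_surjective n w
    obtain ⟨x, y, hy⟩ := hsurj _ (K.d_iCycles_apply n m z)
    refine ⟨x, ?_⟩
    change K.homologyπ n (K.liftCycles φ m hm hφ x) = _
    rw [eq_comm, ← sub_eq_zero, ← map_sub, K.homologyπ_eq_zero_iff hi]
    exact ⟨y, by rw [hy, map_sub, K.liftCycles_i_apply]⟩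

end HomologicalComplex

/-- Dimension shifting when the middle complex is acyclic in the upper degree. -/
theorem CategoryTheory.ShortComplex.ShortExact.nonempty_quotient_range_equiv
    {ι : Type*} {c : ComplexShape ι}
    {S : ShortComplex (HomologicalComplex (ModuleCat.{v} k) c)} (hS : S.ShortExact)
    (i j : ι) (hij : c.Rel i j) (hj : Limits.IsZero (S.X₂.homology j))
    {N₂ N₃ : ModuleCat.{v} k} (e₂ : N₂ ⟶ S.X₂.homology i) (e₃ : N₃ ⟶ S.X₃.homology i)
    (h₂ : Function.Bijective e₂) (h₃ : Function.Bijective e₃) (q : N₂ ⟶ N₃)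
    (hq : e₂ ≫ HomologicalComplex.homologyMap S.g i = q ≫ e₃) :
    Nonempty ((N₃ ⧸ LinearMap.range q.hom) ≃ₗ[k] S.X₁.homology j) := by
  -- Vanishing of the middle term in degree `j` makes the connecting map onto. Degree `i` of the
  -- middle term may be nonzero, which is why a cokernel appears.
  have := hS.epi_δ i j hij hj
  have hsurj : Function.Surjective (hS.δ i j hij) :=
    (ModuleCat.epi_iff_surjective _).1 inferInstance
  have hex := (ShortComplex.moduleCat_exact_iff _).1 (hS.homology_exact₃ i j hij)
  -- By exactness the kernel of the connecting map is the image of the middle cohomology, which the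
  -- square `hq` identifies with the range of `q`.
  have hker : LinearMap.range q.hom = LinearMap.ker (e₃ ≫ hS.δ i j hij).hom := by
    ext x
    constructor
    · rintro ⟨y, rfl⟩
      change (q ≫ e₃ ≫ hS.δ i j hij) y = 0
      rw [← Category.assoc, ← hq, Category.assoc, hS.comp_δ, Limits.comp_zero]
      rfl
    · intro hx
      obtain ⟨w, hw⟩ := hex (e₃ x) hx
      obtain ⟨y, rfl⟩ := h₂.2 w
      refine ⟨y, h₃.1 ?_⟩
      exact (ConcreteCategory.congr_hom hq y).symm.trans hw
  exact ⟨(Submodule.quotEquivOfEq _ _ hker).trans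
    (LinearMap.quotKerEquivOfSurjective _ (hsurj.comp h₃.2))⟩

/-! ### Complexes given by sequences of linear maps -/

section SequenceComplex

variable {X Y Z : ℕ → Type v}
  [∀ n, AddCommGroup (X n)] [∀ n, Module k (X n)]
  [∀ n, AddCommGroup (Y n)] [∀ n, Module k (Y n)]
  [∀ n, AddCommGroup (Z n)] [∀ n, Module k (Z n)]

/-- The cochain complex of a sequence of `k`-modules and `k`-linear differentials. -/
noncomputable def sequenceComplex (d : ∀ n, X n →ₗ[k] X (n + 1))
    (hd : ∀ n, d (n + 1) ∘ₗ d n = 0) : CochainComplex (ModuleCat.{v} k) ℕ :=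
  CochainComplex.of (fun n => ModuleCat.of k (X n)) (fun n => ModuleCat.ofHom (d n))
    (fun n => by rw [← ModuleCat.ofHom_comp, hd]; rfl)

variable {d : ∀ n, X n →ₗ[k] X (n + 1)} {hd : ∀ n, d (n + 1) ∘ₗ d n = 0}
  {d' : ∀ n, Y n →ₗ[k] Y (n + 1)} {hd' : ∀ n, d' (n + 1) ∘ₗ d' n = 0}
  {d'' : ∀ n, Z n →ₗ[k] Z (n + 1)} {hd'' : ∀ n, d'' (n + 1) ∘ₗ d'' n = 0}

theorem sequenceComplex_d (n : ℕ) :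
    (sequenceComplex d hd).d n (n + 1) = ModuleCat.ofHom (d n) :=
  (CochainComplex.of_d (fun n => ModuleCat.of k (X n)) (fun n => ModuleCat.ofHom (d n)) n)

/-- A morphism of complexes given by linear maps that commute with the differentials. -/
noncomputable def sequenceComplexMap (f : ∀ n, X n →ₗ[k] Y n)
    (hf : ∀ n, d' n ∘ₗ f n = f (n + 1) ∘ₗ d n) :
    sequenceComplex d hd ⟶ sequenceComplex d' hd' where
  f n := ModuleCat.ofHom (f n)
  comm' := by
    rintro n _ rfl
    rw [sequenceComplex_d, sequenceComplex_d]
    exact congrArg ModuleCat.ofHom (hf n)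

/-- A degreewise exact sequence of complexes. -/
noncomputable def sequenceShortComplex (f : ∀ n, X n →ₗ[k] Y n) (g : ∀ n, Y n →ₗ[k] Z n)
    (hf : ∀ n, d' n ∘ₗ f n = f (n + 1) ∘ₗ d n) (hg : ∀ n, d'' n ∘ₗ g n = g (n + 1) ∘ₗ d' n)
    (hfg : ∀ n, Function.Exact (f n) (g n)) :
    ShortComplex (CochainComplex (ModuleCat.{v} k) ℕ) :=
  ShortComplex.mk (sequenceComplexMap (hd := hd) (hd' := hd') f hf)
    (sequenceComplexMap (hd := hd') (hd' := hd'') g hg) (by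
      ext n x
      exact (hfg n).apply_apply_eq_zero x)

theorem sequenceShortComplex_shortExact (f : ∀ n, X n →ₗ[k] Y n) (g : ∀ n, Y n →ₗ[k] Z n)
    (hf : ∀ n, d' n ∘ₗ f n = f (n + 1) ∘ₗ d n) (hg : ∀ n, d'' n ∘ₗ g n = g (n + 1) ∘ₗ d' n)
    (hfg : ∀ n, Function.Exact (f n) (g n)) (hinj : ∀ n, Function.Injective (f n))
    (hsurj : ∀ n, Function.Surjective (g n)) :
    (sequenceShortComplex (hd := hd) (hd' := hd') (hd'' := hd'') f g hf hg hfg).ShortExact :=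
  HomologicalComplex.shortExact_of_degreewise_shortExact _ fun n =>
    ModuleCat.shortComplex_shortExact _ (hfg n) (hinj n) (hsurj n)

theorem isZero_homology_sequenceComplex_succ (n : ℕ)
    (h : ∀ x, d (n + 1) x = 0 → ∃ y, d n y = x) :
    Limits.IsZero ((sequenceComplex d hd).homology (n + 1)) := by
  rw [ModuleCat.isZero_iff_forall_eq_zero]
  intro w
  obtain ⟨z, rfl⟩ := HomologicalComplex.homologyπ_surjective _ _ w
  rw [HomologicalComplex.homologyπ_eq_zero_iff _ (CochainComplex.prev_nat_succ n),
    sequenceComplex_d]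
  have hz := HomologicalComplex.d_iCycles_apply _ (n + 1) (n + 1 + 1) z
  rw [sequenceComplex_d] at hz
  exact h _ hz

theorem isZero_homology_sequenceComplex_zero (h : ∀ x, d 0 x = 0 → x = 0) :
    Limits.IsZero ((sequenceComplex d hd).homology 0) := by
  rw [ModuleCat.isZero_iff_forall_eq_zero]
  intro w
  obtain ⟨z, rfl⟩ := HomologicalComplex.homologyπ_surjective _ _ w
  have hz := HomologicalComplex.d_iCycles_apply _ 0 (0 + 1) z
  rw [sequenceComplex_d] at hz
  have : z = 0 := HomologicalComplex.iCycles_injective _ _ ((h _ hz).trans (map_zero _).symm)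
  rw [this, map_zero]

/-! ### Explicit representatives of cohomology classes -/

section CocycleClass

variable {N : Type v} [AddCommGroup N] [Module k N] {N' : Type v} [AddCommGroup N'] [Module k N']

variable (hd) in
/-- The map to cohomology induced by a linear map to the cocycles. -/
noncomputable def sequenceClass (n : ℕ) (φ : N →ₗ[k] X n) (hφ : d n ∘ₗ φ = 0) :
    ModuleCat.of k N ⟶ (sequenceComplex d hd).homology n :=
  HomologicalComplex.cocycleClass (sequenceComplex d hd) (CochainComplex.next ℕ n)
    (ModuleCat.ofHom φ) (by rw [sequenceComplex_d]; exact congrArg ModuleCat.ofHom hφ)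

theorem sequenceClass_bijective_zero (φ : N →ₗ[k] X 0) (hφ : d 0 ∘ₗ φ = 0)
    (hinj : ∀ x, φ x = 0 → x = 0) (hsurj : ∀ z, d 0 z = 0 → ∃ x, φ x = z) :
    Function.Bijective (sequenceClass hd 0 φ hφ) := by
  refine HomologicalComplex.cocycleClass_bijective _ CochainComplex.prev_nat_zero _ _ _ ?_ ?_
  · intro x y hy
    -- The predecessor of degree 0 is by convention 0 itself, with zero differential, so the only
    -- coboundary is 0.
    rw [HomologicalComplex.shape _ 0 0 (by simp)] at hy
    exact hinj x hy.symm
  · intro z hz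
    rw [sequenceComplex_d] at hz
    obtain ⟨x, hx⟩ := hsurj z hz
    exact ⟨x, 0, (map_zero _).trans (sub_eq_zero.2 hx.symm).symm⟩

theorem sequenceClass_bijective_succ (n : ℕ) (φ : N →ₗ[k] X (n + 1)) (hφ : d (n + 1) ∘ₗ φ = 0)
    (hinj : ∀ x y, d n y = φ x → x = 0)
    (hsurj : ∀ z, d (n + 1) z = 0 → ∃ x y, d n y = z - φ x) :
    Function.Bijective (sequenceClass hd (n + 1) φ hφ) := by
  refine HomologicalComplex.cocycleClass_bijective _ (CochainComplex.prev_nat_succ n) _ _ _ ?_ ?_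
  · intro x y hy
    rw [sequenceComplex_d] at hy
    exact hinj x y hy
  · intro z hz
    rw [sequenceComplex_d] at hz ⊢
    exact hsurj z hz

theorem sequenceClass_comp_homologyMap (n : ℕ) (φ : N →ₗ[k] X n) (hφ : d n ∘ₗ φ = 0)
    (φ' : N' →ₗ[k] Y n) (hφ' : d' n ∘ₗ φ' = 0) (f : ∀ n, X n →ₗ[k] Y n)
    (hf : ∀ n, d' n ∘ₗ f n = f (n + 1) ∘ₗ d n) (q : N →ₗ[k] N') (h : f n ∘ₗ φ = φ' ∘ₗ q) :
    sequenceClass hd n φ hφ ≫ HomologicalComplex.homologyMap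
        (sequenceComplexMap (hd := hd) (hd' := hd') f hf) n =
      ModuleCat.ofHom q ≫ sequenceClass hd' n φ' hφ' :=
  HomologicalComplex.cocycleClass_comp_homologyMap _ _ _ _ _ _ _ (congrArg ModuleCat.ofHom h)

end CocycleClass

/-! ### Cohomology of a product of complexes -/

section Product

theorem prodMap_comp_eq_zero (n : ℕ) (hd : ∀ n, d (n + 1) ∘ₗ d n = 0)
    (hd' : ∀ n, d' (n + 1) ∘ₗ d' n = 0) :
    (d (n + 1)).prodMap (d' (n + 1)) ∘ₗ (d n).prodMap (d' n) = 0 := by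
  rw [LinearMap.prodMap_comp, hd, hd', LinearMap.prodMap_zero]

variable (d hd d' hd')

/-- The product of two complexes. -/
noncomputable abbrev prodSequenceComplex : CochainComplex (ModuleCat.{v} k) ℕ :=
  sequenceComplex (X := fun n => X n × Y n) (fun n => (d n).prodMap (d' n))
    (fun n => prodMap_comp_eq_zero n hd hd')

/-- The cohomology of a product of complexes. -/
noncomputable def homologyProdEquiv (n : ℕ) :
    (prodSequenceComplex d hd d' hd').homology n ≃ₗ[k]
      (sequenceComplex d hd).homology n × (sequenceComplex d' hd').homology n := by
  let K := prodSequenceComplex d hd d' hd'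
  let p₁ : K ⟶ sequenceComplex d hd :=
    sequenceComplexMap (fun n => LinearMap.fst k (X n) (Y n)) (fun n => rfl)
  let p₂ : K ⟶ sequenceComplex d' hd' :=
    sequenceComplexMap (fun n => LinearMap.snd k (X n) (Y n)) (fun n => rfl)
  let i₁ : sequenceComplex d hd ⟶ K :=
    sequenceComplexMap (fun n => LinearMap.inl k (X n) (Y n)) (fun n => by ext <;> simp)
  let i₂ : sequenceComplex d' hd' ⟶ K :=
    sequenceComplexMap (fun n => LinearMap.inr k (X n) (Y n)) (fun n => by ext <;> simp)
  -- The biproduct relations survive in cohomology because taking cohomology is additive.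
  have h₁₁ : i₁ ≫ p₁ = 𝟙 _ := by ext n x; rfl
  have h₂₂ : i₂ ≫ p₂ = 𝟙 _ := by ext n x; rfl
  have h₁₂ : i₁ ≫ p₂ = 0 := by ext n x; rfl
  have h₂₁ : i₂ ≫ p₁ = 0 := by ext n x; rfl
  have hsum : p₁ ≫ i₁ + p₂ ≫ i₂ = 𝟙 _ := by
    ext n x
    exact Prod.ext (add_zero _) (zero_add _)
  let H {K L : CochainComplex (ModuleCat.{v} k) ℕ} (f : K ⟶ L) :=
    HomologicalComplex.homologyMap f n
  have H_comp : ∀ {K L N : CochainComplex (ModuleCat.{v} k) ℕ} (f : K ⟶ L) (g : L ⟶ N)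
      (x : K.homology n), H g (H f x) = H (f ≫ g) x := fun f g x =>
    (ConcreteCategory.congr_hom (HomologicalComplex.homologyMap_comp f g n) x).symm
  refine LinearEquiv.ofLinearMap ((H p₁).hom.prod (H p₂).hom) ((H i₁).hom.coprod (H i₂).hom) ?_ ?_
  · refine LinearMap.ext fun x => ?_
    refine Prod.ext ?_ ?_
    · change H p₁ (H i₁ x.1 + H i₂ x.2) = x.1
      rw [map_add, H_comp, H_comp, h₁₁, h₂₁]
      simp [H]
    · change H p₂ (H i₁ x.1 + H i₂ x.2) = x.2
      rw [map_add, H_comp, H_comp, h₁₂, h₂₂]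
      simp [H]
  · refine LinearMap.ext fun x => ?_
    change H i₁ (H p₁ x) + H i₂ (H p₂ x) = x
    rw [H_comp, H_comp]
    have := ConcreteCategory.congr_hom (congrArg H hsum) x
    simpa [H] using this

end Product

end SequenceComplex

end Complexes

/-- The long exact cohomology sequence, with the outer terms replaced by isomorphic modules. -/
theorem CategoryTheory.ShortComplex.ShortExact.exists_long_exact_sequence {k : Type u} [CommRing k]
    {S : ShortComplex (CochainComplex (ModuleCat.{v} k) ℕ)} (hS : S.ShortExact)
    (hzero : Limits.IsZero (S.X₁.homology 0)) {N₁ N₃ : ℕ → Type v}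
    [∀ n, AddCommGroup (N₁ n)] [∀ n, Module k (N₁ n)]
    [∀ n, AddCommGroup (N₃ n)] [∀ n, Module k (N₃ n)]
    (e : ∀ n, S.X₁.homology (n + 1) ≃ₗ[k] N₁ n) (p : ∀ n, S.X₃.homology n ≃ₗ[k] N₃ n) :
    ∃ (j : ∀ n, S.X₂.homology n →ₗ[k] N₃ n) (δ : ∀ n, N₃ n →ₗ[k] N₁ n)
      (π : ∀ n, N₁ n →ₗ[k] S.X₂.homology (n + 1)),
      Function.Injective (j 0) ∧
        ∀ n : ℕ, Function.Exact (j n) (δ n) ∧ Function.Exact (δ n) (π n) ∧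
          Function.Exact (π n) (j (n + 1)) := by
  let r (n : ℕ) := (HomologicalComplex.homologyMap S.g n).hom
  let i (n : ℕ) := (HomologicalComplex.homologyMap S.f n).hom
  let conn (n : ℕ) := (hS.δ n (n + 1) rfl).hom
  have hir (n : ℕ) : Function.Exact (i n) (r n) :=
    (ShortComplex.ShortExact.moduleCat_exact_iff_function_exact _).1 (hS.homology_exact₂ n)
  have hrd (n : ℕ) : Function.Exact (r n) (conn n) :=
    (ShortComplex.ShortExact.moduleCat_exact_iff_function_exact _).1
      (hS.homology_exact₃ n (n + 1) rfl)
  have hdi (n : ℕ) : Function.Exact (conn n) (i (n + 1)) :=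
    (ShortComplex.ShortExact.moduleCat_exact_iff_function_exact _).1
      (hS.homology_exact₁ n (n + 1) rfl)
  -- The module `N₁ n` stands for degree `n + 1` of the first complex, so the connecting map out of
  -- degree `n` ends in `N₁ n` without a shift.
  refine ⟨fun n => (p n).toLinearMap ∘ₗ r n, fun n => (e n).toLinearMap ∘ₗ conn n ∘ₗ (p n).symm,
    fun n => i (n + 1) ∘ₗ (e n).symm, ?_, fun n => ⟨?_, ?_, ?_⟩⟩
  -- The kernel of the degree-zero restriction is the image of the vanishing degree-zero cohomology
  -- of the first complex.
  · refine (p 0).injective.comp ?_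
    rw [injective_iff_map_eq_zero]
    intro x hx
    obtain ⟨y, rfl⟩ := (hir 0 x).1 hx
    have hy : y = 0 := (ModuleCat.isZero_iff_forall_eq_zero _).1 hzero y
    rw [hy, map_zero]
  · intro x
    simp only [LinearMap.comp_apply, LinearEquiv.coe_coe, LinearEquiv.map_eq_zero_iff]
    rw [hrd n]
    simp only [Set.mem_range, LinearMap.comp_apply, LinearEquiv.coe_coe,
      LinearEquiv.eq_symm_apply]
  · intro x
    simp only [LinearMap.comp_apply, LinearEquiv.coe_coe]
    rw [hdi n]
    constructor
    · rintro ⟨y, hy⟩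
      exact ⟨p n y, by simp [hy]⟩
    · rintro ⟨y, rfl⟩
      exact ⟨(p n).symm y, by simp⟩
  · intro x
    simp only [LinearMap.comp_apply, LinearEquiv.coe_coe, LinearEquiv.map_eq_zero_iff]
    rw [hir (n + 1)]
    constructor
    · rintro ⟨y, rfl⟩
      exact ⟨e n y, by simp⟩
    · rintro ⟨y, rfl⟩
      exact ⟨(e n).symm y, by simp⟩

/-! ### Functoriality and acyclicity of Hochschild cochains -/

section HochschildFunctoriality

variable {k : Type u} [CommRing k]
  {C : Type v} [Ring C] [Algebra k C]
  {Y : Type v} [AddCommGroup Y] [Module k Y] [Module C Y] [Module Cᵐᵒᵖ Y]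
  [IsScalarTower k C Y] [IsScalarTower k Cᵐᵒᵖ Y] [SMulCommClass C Cᵐᵒᵖ Y]
  {D : Type v} [Ring D] [Algebra k D]
  {Z : Type v} [AddCommGroup Z] [Module k Z] [Module D Z] [Module Dᵐᵒᵖ Z]
  [IsScalarTower k D Z] [IsScalarTower k Dᵐᵒᵖ Z] [SMulCommClass D Dᵐᵒᵖ Z]

theorem hochschildD_apply (n : ℕ) (f : HochschildCochain k C Y n) (c : Fin (n + 1) → C) :
    hochschildD k C Y n f c =
      ∑ i : Fin (n + 2), (-1 : ℤ) ^ (i : ℕ) • hochschildCofaceFun i f c := by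
  simp only [hochschildD, LinearMap.sum_apply, LinearMap.smul_apply, sum_apply, smul_apply]
  rfl

/-- Hochschild cochains are contravariant in the algebra and covariant in the bimodule. -/
def hochschildMap (ρ : D →ₗ[k] C) (p : Y →ₗ[k] Z) (n : ℕ) :
    HochschildCochain k C Y n →ₗ[k] HochschildCochain k D Z n where
  toFun f := p.compMultilinearMap (f.compLinearMap fun _ => ρ)
  map_add' f g := by ext; simp
  map_smul' r f := by ext; simp

@[simp] theorem hochschildMap_apply (ρ : D →ₗ[k] C) (p : Y →ₗ[k] Z) (n : ℕ)
    (f : HochschildCochain k C Y n) (c : Fin n → D) :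
    hochschildMap ρ p n f c = p (f fun i => ρ (c i)) :=
  rfl

/-- The differential uses products and actions but never the unit. Hence `ρ` need not be unital, and
the inclusions of A and B as corners of E are covered. -/
theorem hochschildD_comp_hochschildMap (ρ : D →ₗ[k] C) (p : Y →ₗ[k] Z)
    (hρ : ∀ x y, ρ (x * y) = ρ x * ρ y) (hp : ∀ x y, p (ρ x • y) = x • p y)
    (hp' : ∀ x y, p (MulOpposite.op (ρ x) • y) = MulOpposite.op x • p y) (n : ℕ) :
    hochschildD k D Z n ∘ₗ hochschildMap ρ p n =
      hochschildMap ρ p (n + 1) ∘ₗ hochschildD k C Y n := by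
  refine LinearMap.ext fun f => MultilinearMap.ext fun c => ?_
  simp only [LinearMap.comp_apply, hochschildMap_apply, hochschildD_apply, map_sum, map_zsmul]
  refine Finset.sum_congr rfl fun i _ => congrArg _ ?_
  simp only [hochschildCofaceFun]
  split_ifs
  · rw [hp]; rfl
  · rw [hp']; rfl
  · rw [hochschildMap_apply]
    congr 2
    funext q
    split_ifs
    · rfl
    · exact hρ _ _
    · rfl

/-- Fix all variables but the first one. -/
def HochschildCochain.firstVariable {n : ℕ} (f : HochschildCochain k C Y (n + 1)) (c : Fin n → C) :
    C →ₗ[k] Y where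
  toFun x := f (Fin.cons x c)
  map_add' x y := f.cons_add c x y
  map_smul' r x := f.cons_smul c r x

@[simp] theorem HochschildCochain.firstVariable_apply {n : ℕ}
    (f : HochschildCochain k C Y (n + 1)) (c : Fin n → C) (x : C) :
    f.firstVariable c x = f (Fin.cons x c) :=
  rfl

/-- Apply a linear map to a cochain regarded as a function of its first variable. -/
def contractFirst (t : (C →ₗ[k] Y) →ₗ[k] Y) {n : ℕ} (f : HochschildCochain k C Y (n + 1)) :
    HochschildCochain k C Y n :=
  MultilinearMap.mk' (fun c => t (f.firstVariable c))
    (fun c i x y => by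
      rw [← map_add]
      congr 1
      ext z
      simp [Fin.cons_update])
    (fun c i r x => by
      rw [← map_smul]
      congr 1
      ext z
      simp [Fin.cons_update])

theorem contractFirst_apply (t : (C →ₗ[k] Y) →ₗ[k] Y) {n : ℕ}
    (f : HochschildCochain k C Y (n + 1)) (c : Fin n → C) :
    contractFirst t f c = t (f.firstVariable c) :=
  rfl

variable (k C Y) in
/-- The bimodule `Y` is a retract of the bimodule `Hom_k(C, Y)`, where `C` acts on the right of `Y`
and on the argument. -/
structure IsLeftCoinduced (t : (C →ₗ[k] Y) →ₗ[k] Y) : Prop where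
  retract : ∀ (g : C →ₗ[k] Y) (y : Y), (∀ x, g x = x • y) → t g = y
  smul : ∀ (g g' : C →ₗ[k] Y) (c : C), (∀ x, g' x = g (x * c)) → t g' = c • t g
  op_smul : ∀ (g g' : C →ₗ[k] Y) (c : C), (∀ x, g' x = MulOpposite.op c • g x) →
    t g' = MulOpposite.op c • t g

variable (k C Y) in
/-- The bimodule `Y` is a retract of the bimodule `Hom_k(C, Y)`, where `C` acts on the left of `Y`
and on the argument. -/
structure IsRightCoinduced (t : (C →ₗ[k] Y) →ₗ[k] Y) : Prop where
  retract : ∀ (g : C →ₗ[k] Y) (y : Y), (∀ x, g x = MulOpposite.op x • y) → t g = y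
  op_smul : ∀ (g g' : C →ₗ[k] Y) (c : C), (∀ x, g' x = g (c * x)) → t g' = MulOpposite.op c • t g
  smul : ∀ (g g' : C →ₗ[k] Y) (c : C), (∀ x, g' x = c • g x) → t g' = c • t g

/-- Contracting homotopy in the first variable. The coface of index 0 turns the first variable into
the action on a value of `f`, which `t` retracts to that value. By equivariance of `t` the coface of
index `i + 1` becomes the coface of index `i`; the shift changes the sign, so these terms cancel
against the differential of the contraction. -/
theorem IsLeftCoinduced.contractFirst_hochschildD {t : (C →ₗ[k] Y) →ₗ[k] Y}
    (ht : IsLeftCoinduced k C Y t) {n : ℕ} (f : HochschildCochain k C Y (n + 1)) :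
    contractFirst t (hochschildD k C Y (n + 1) f) + hochschildD k C Y n (contractFirst t f) =
      f := by
  have hzero : ∀ c, t ((hochschildCoface k C Y (n + 1) 0 f).firstVariable c) = f c := fun c =>
    ht.retract _ _ fun x => by
      simp [hochschildCoface, hochschildCofaceFun]
  have hsucc : ∀ c (i : Fin (n + 2)),
      t ((hochschildCoface k C Y (n + 1) i.succ f).firstVariable c) =
        hochschildCofaceFun i (contractFirst t f) c := by
    intro c i
    simp only [hochschildCofaceFun]
    split_ifs with h0 h1
    · refine ht.smul _ _ _ fun x => ?_
      simp only [hochschildCoface, hochschildCofaceFun, HochschildCochain.firstVariable_apply,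
        LinearMap.coe_mk, AddHom.coe_mk, MultilinearMap.coe_mk, Fin.val_succ, h0]
      simp only [zero_add, one_ne_zero, if_false, Nat.right_eq_add]
      rw [if_neg (by omega)]
      congr 1
      funext q
      refine Fin.cases ?_ (fun q => ?_) q
      · simp [Fin.castSucc_zero]
      · simp
    · refine ht.op_smul _ _ _ fun x => ?_
      simp only [hochschildCoface, hochschildCofaceFun, HochschildCochain.firstVariable_apply,
        LinearMap.coe_mk, AddHom.coe_mk, MultilinearMap.coe_mk, Fin.val_succ, h1]
      simp only [Nat.add_eq_zero_iff, one_ne_zero, and_false, if_false, if_true, ← Fin.succ_last,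
        Fin.cons_succ]
      congr 2
      funext q
      refine Fin.cases ?_ (fun q => ?_) q
      · simp [Fin.castSucc_zero]
      · simp [← Fin.succ_castSucc]
    · rw [contractFirst_apply]
      congr 1
      ext x
      simp only [hochschildCoface, hochschildCofaceFun, HochschildCochain.firstVariable_apply,
        LinearMap.coe_mk, AddHom.coe_mk, MultilinearMap.coe_mk, Fin.val_succ]
      rw [if_neg (by omega), if_neg (by omega)]
      congr 1
      funext q
      refine Fin.cases ?_ (fun q => ?_) q
      · rw [if_pos (by rw [Fin.val_zero]; omega)]
        simp [Fin.castSucc_zero]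
      · simp [← Fin.succ_castSucc]
  ext c
  rw [add_apply, contractFirst_apply, hochschildD_apply]
  have : (hochschildD k C Y (n + 1) f).firstVariable c =
      ∑ i : Fin (n + 3), (-1 : ℤ) ^ (i : ℕ) •
        (hochschildCoface k C Y (n + 1) i f).firstVariable c := by
    ext x
    simp only [HochschildCochain.firstVariable_apply, LinearMap.sum_apply, LinearMap.smul_apply,
      hochschildD_apply]
    rfl
  rw [this, map_sum, Fin.sum_univ_succ]
  simp only [map_zsmul, hzero, hsucc]
  simp only [Fin.val_zero, pow_zero, one_smul, Fin.val_succ, pow_succ,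
    mul_neg, mul_one, neg_smul, Finset.sum_neg_distrib, neg_add_cancel_right]

/-- The mirror image, in the last variable. Now the last coface is the one that is retracted, and it
contributes its sign `(-1) ^ (n + 2)`; the other cofaces keep their indices and signs. -/
theorem IsRightCoinduced.contractLast_hochschildD {t : (C →ₗ[k] Y) →ₗ[k] Y}
    (ht : IsRightCoinduced k C Y t) {n : ℕ} (f : HochschildCochain k C Y (n + 1)) :
    t.compMultilinearMap (hochschildD k C Y (n + 1) f).curryRight =
      hochschildD k C Y n (t.compMultilinearMap f.curryRight) + (-1 : ℤ) ^ (n + 2) • f := by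
  have hlast : ∀ c, t ((hochschildCoface k C Y (n + 1) (Fin.last _) f).curryRight c) = f c :=
    fun c => ht.retract _ _ fun x => by
      simp [hochschildCoface, hochschildCofaceFun]
  have hcast : ∀ c (i : Fin (n + 2)),
      t ((hochschildCoface k C Y (n + 1) i.castSucc f).curryRight c) =
        hochschildCofaceFun i (t.compMultilinearMap f.curryRight) c := by
    intro c i
    simp only [hochschildCofaceFun]
    split_ifs with h0 h1
    · refine ht.smul _ _ _ fun x => ?_
      simp only [hochschildCoface, hochschildCofaceFun, MultilinearMap.curryRight_apply,
        LinearMap.coe_mk, AddHom.coe_mk, MultilinearMap.coe_mk, Fin.val_castSucc, h0]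
      simp only [if_true, ← Fin.castSucc_zero, Fin.snoc_castSucc]
      congr 2
      funext q
      refine Fin.lastCases ?_ (fun q => ?_) q
      · simp
      · simp only [Fin.val_castSucc, Fin.succ_castSucc, Fin.snoc_castSucc]
    · refine ht.op_smul _ _ _ fun x => ?_
      simp only [hochschildCoface, hochschildCofaceFun, MultilinearMap.curryRight_apply,
        LinearMap.coe_mk, AddHom.coe_mk, MultilinearMap.coe_mk, Fin.val_castSucc, h1]
      rw [if_neg (by omega), if_neg (by omega)]
      congr 1
      funext q
      refine Fin.lastCases ?_ (fun q => ?_) q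
      · simp
      · simp
    · rw [LinearMap.compMultilinearMap_apply]
      congr 1
      ext x
      simp only [hochschildCoface, hochschildCofaceFun, MultilinearMap.curryRight_apply,
        LinearMap.coe_mk, AddHom.coe_mk, MultilinearMap.coe_mk, Fin.val_castSucc]
      rw [if_neg (by omega), if_neg (by omega)]
      congr 1
      funext q
      refine Fin.lastCases ?_ (fun q => ?_) q
      · rw [if_neg (by simp; omega), if_neg (by simp; omega)]
        simp
      · simp only [Fin.val_castSucc, Fin.succ_castSucc, Fin.snoc_castSucc]
  ext c
  rw [add_apply, LinearMap.compMultilinearMap_apply, hochschildD_apply]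
  have : (hochschildD k C Y (n + 1) f).curryRight c =
      ∑ i : Fin (n + 3), (-1 : ℤ) ^ (i : ℕ) •
        (hochschildCoface k C Y (n + 1) i f).curryRight c := by
    ext x
    simp only [MultilinearMap.curryRight_apply, LinearMap.sum_apply, LinearMap.smul_apply,
      hochschildD_apply]
    rfl
  rw [this, map_sum, Fin.sum_univ_castSucc]
  simp only [map_zsmul, hlast, hcast, Fin.val_castSucc, Fin.val_last, smul_apply]

theorem IsLeftCoinduced.exists_hochschildD_eq {t : (C →ₗ[k] Y) →ₗ[k] Y}
    (ht : IsLeftCoinduced k C Y t) {n : ℕ} (f : HochschildCochain k C Y (n + 1))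
    (hf : hochschildD k C Y (n + 1) f = 0) : ∃ g, hochschildD k C Y n g = f := by
  refine ⟨contractFirst t f, ?_⟩
  have h := ht.contractFirst_hochschildD f
  have h0 : contractFirst t (0 : HochschildCochain k C Y (n + 2)) = 0 := by
    ext c
    rw [contractFirst_apply]
    exact (congrArg t (by ext; rfl)).trans (map_zero t)
  rwa [hf, h0, zero_add] at h

theorem IsRightCoinduced.exists_hochschildD_eq {t : (C →ₗ[k] Y) →ₗ[k] Y}
    (ht : IsRightCoinduced k C Y t) {n : ℕ} (f : HochschildCochain k C Y (n + 1))
    (hf : hochschildD k C Y (n + 1) f = 0) : ∃ g, hochschildD k C Y n g = f := by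
  -- For a cocycle the identity reads d(t f) = -(-1)ⁿ⁺² f = (-1)ⁿ⁺¹ f; the factor undoes this sign.
  refine ⟨(-1 : ℤ) ^ (n + 1) • t.compMultilinearMap f.curryRight, ?_⟩
  have h := ht.contractLast_hochschildD f
  have h0 : t.compMultilinearMap (0 : HochschildCochain k C Y (n + 2)).curryRight = 0 := by
    ext c
    exact (congrArg t (by ext; rfl)).trans (map_zero t)
  rw [hf, h0, eq_comm, add_eq_zero_iff_eq_neg] at h
  rw [map_zsmul, h, ← neg_smul, smul_smul, mul_neg, ← pow_add,
    show n + 1 + (n + 2) = 2 * (n + 1) + 1 by ring, pow_succ, pow_mul]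
  simp

end HochschildFunctoriality

/-! ### Relative `Ext`: exact sequences, acyclicity and degree zero -/

section RelativeExtLemmas

variable {k : Type u} [CommRing k] {R : Type v} [Ring R] [Algebra k R]
  {N : Type v} [AddCommGroup N] [Module k N] [Module R N] [IsScalarTower k R N]

namespace RelProjResolution

variable (P : RelProjResolution k R N)

section

variable (Y : Type v) [AddCommGroup Y] [Module k Y] [Module R Y] [IsScalarTower k R Y]

/-- The differential of the complex `Hom_R(X_*, Y)`. -/
def homD (n : ℕ) : (P.X n →ₗ[R] Y) →ₗ[k] (P.X (n + 1) →ₗ[R] Y) :=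
  LinearMap.lcomp k Y (P.d n)

theorem homD_comp (n : ℕ) : P.homD Y (n + 1) ∘ₗ P.homD Y n = 0 := by
  ext f x
  exact (congrArg f (LinearMap.congr_fun (P.d_comp_d n) x)).trans (map_zero f)

end

theorem exists_d_eq {n : ℕ} {x : P.X (n + 1)} (hx : P.d n x = 0) : ∃ y, P.d (n + 1) y = x := by
  obtain ⟨s, hs⟩ := P.split_succ n
  exact ⟨s ⟨x, hx⟩, hs ⟨x, hx⟩⟩

/-- A k-linear partial inverse of each differential, assembled from the splittings. If d h d = d one
degree lower, then id - h d projects onto the kernel of d, where the chosen section is defined; in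
degree 0 the same is done with π and its section. -/
theorem exists_d_comp_d_eq (n : ℕ) :
    ∃ h : P.X n →ₗ[k] P.X (n + 1), ∀ x, P.d n (h (P.d n x)) = P.d n x := by
  induction n with
  | zero =>
    obtain ⟨s, hs⟩ := P.split_π
    obtain ⟨s', hs'⟩ := P.split_zero
    refine ⟨s' ∘ₗ (LinearMap.id - s ∘ₗ P.π.restrictScalars k).codRestrict
      ((LinearMap.ker P.π).restrictScalars k) (fun x => by simp [hs]), fun x => ?_⟩
    have hx : P.π (P.d 0 x) = 0 := LinearMap.congr_fun P.π_comp_d x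
    refine (hs' _).trans ?_
    change P.d 0 x - s (P.π (P.d 0 x)) = P.d 0 x
    rw [hx, map_zero, sub_zero]
  | succ n ih =>
    obtain ⟨h, hh⟩ := ih
    obtain ⟨s, hs⟩ := P.split_succ n
    refine ⟨s ∘ₗ (LinearMap.id - h ∘ₗ (P.d n).restrictScalars k).codRestrict
      ((LinearMap.ker (P.d n)).restrictScalars k) (fun x => by simp [hh]), fun x => ?_⟩
    have hx : P.d n (P.d (n + 1) x) = 0 := LinearMap.congr_fun (P.d_comp_d n) x
    refine (hs _).trans ?_
    change P.d (n + 1) x - h (P.d n (P.d (n + 1) x)) = P.d (n + 1) x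
    rw [hx, map_zero, sub_zero]

section

variable (Y : Type v) [AddCommGroup Y] [Module k Y] [Module R Y] [IsScalarTower k R Y]

/-- Relative `Ext` into a retract of the coinduced module `Hom_k(R, Y)` vanishes in positive
degrees. -/
theorem isZero_homology_homD_succ (T : (R →ₗ[k] Y) → Y)
    (retract : ∀ (g : R →ₗ[k] Y) (y : Y), (∀ r, g r = r • y) → T g = y)
    (add : ∀ g g', T (g + g') = T g + T g')
    (smul : ∀ (g g' : R →ₗ[k] Y) (r : R), (∀ x, g' x = g (x * r)) → T g' = r • T g) (n : ℕ) :
    Limits.IsZero ((sequenceComplex (P.homD Y) (P.homD_comp Y)).homology (n + 1)) := by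
  refine isZero_homology_sequenceComplex_succ n fun f hf => ?_
  obtain ⟨h, hh⟩ := P.exists_d_comp_d_eq n
  -- The candidate primitive f ∘ h is only k-linear. Letting `r` act on its argument gives an
  -- R-linear map into Hom_k(R, Y), and `T` brings it back to `Y`.
  let g (x : P.X n) : R →ₗ[k] Y :=
    f.restrictScalars k ∘ₗ h ∘ₗ (LinearMap.toSpanSingleton R (P.X n) x).restrictScalars k
  have hg : ∀ x r, g x r = f (h (r • x)) := fun x r => rfl
  refine ⟨{ toFun := fun x => T (g x)
            map_add' := fun x y => ?_
            map_smul' := fun r x => ?_ }, ?_⟩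
  · rw [← add]
    congr 1
    ext r
    simp [hg]
  · exact smul _ _ _ fun r' => by simp [hg, mul_smul]
  · ext x
    refine retract _ _ fun r => ?_
    -- For y = r x the element h(d y) - y is a cycle, hence a boundary, and the cocycle `f` kills
    -- boundaries.
    rw [hg, ← map_smul, ← map_smul, ← sub_eq_zero, ← map_sub]
    obtain ⟨y, hy⟩ : ∃ y, P.d (n + 1) y = h (P.d n (r • x)) - r • x :=
      P.exists_d_eq (by rw [map_sub, hh, sub_self])
    rw [← hy]
    exact LinearMap.congr_fun hf y

/-- The map `Hom_R(N, Y) → Ext⁰(N, Y)`. -/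
noncomputable def homToExtZero : ModuleCat.of k (N →ₗ[R] Y) ⟶
    (sequenceComplex (P.homD Y) (P.homD_comp Y)).homology 0 :=
  sequenceClass _ 0 (LinearMap.lcomp k Y P.π) (by
    refine LinearMap.ext fun f => LinearMap.ext fun x => ?_
    exact (congrArg f (LinearMap.congr_fun P.π_comp_d x)).trans (map_zero f))

/-- The resolution presents `N` as the cokernel of its first differential, so a 0-cocycle is a map
that factors uniquely through `N`. -/
theorem homToExtZero_bijective : Function.Bijective (P.homToExtZero Y) := by
  obtain ⟨s, hs⟩ := P.split_π
  obtain ⟨s', hs'⟩ := P.split_zero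
  have hπ : Function.Surjective P.π := fun x => ⟨s x, hs x⟩
  refine sequenceClass_bijective_zero _ _ ?_ ?_
  · intro g hg
    refine LinearMap.ext fun x => ?_
    obtain ⟨x, rfl⟩ := hπ x
    exact LinearMap.congr_fun hg x
  · intro z hz
    have hker : LinearMap.ker P.π ≤ LinearMap.ker z := fun x hx => by
      have := LinearMap.congr_fun hz (s' ⟨x, hx⟩)
      exact (congrArg z (hs' ⟨x, hx⟩)).symm.trans this
    refine ⟨(LinearMap.ker P.π).liftQ z hker ∘ₗ
      (P.π.quotKerEquivOfSurjective hπ).symm.toLinearMap, ?_⟩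
    refine LinearMap.ext fun x => ?_
    change (LinearMap.ker P.π).liftQ z hker
      ((P.π.quotKerEquivOfSurjective hπ).symm (P.π x)) = z x
    have : (P.π.quotKerEquivOfSurjective hπ).symm (P.π x) = Submodule.Quotient.mk x := by
      rw [LinearEquiv.symm_apply_eq]
      rfl
    rw [this]
    rfl

end

/-! ### Relative Hom along sequences split over k -/

section ShortExact

variable {Y₁ Y₂ Y₃ : Type v} [AddCommGroup Y₁] [Module k Y₁] [Module R Y₁] [IsScalarTower k R Y₁]
  [AddCommGroup Y₂] [Module k Y₂] [Module R Y₂] [IsScalarTower k R Y₂]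
  [AddCommGroup Y₃] [Module k Y₃] [Module R Y₃] [IsScalarTower k R Y₃]

variable (k N) in
/-- Composition with an `R`-linear map, as a `k`-linear map. -/
def homPostcomp (f : Y₁ →ₗ[R] Y₂) : (N →ₗ[R] Y₁) →ₗ[k] (N →ₗ[R] Y₂) where
  toFun g := f ∘ₗ g
  map_add' g h := LinearMap.comp_add g h f
  map_smul' r g := by
    ext x
    exact map_smul (f.restrictScalars k) r (g x)

theorem homPostcomp_exact (f : Y₁ →ₗ[R] Y₂) (g : Y₂ →ₗ[R] Y₃) (hf : Function.Injective f)
    (hfg : Function.Exact f g) : Function.Exact (homPostcomp k N f) (homPostcomp k N g) := by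
  intro h
  constructor
  · intro hh
    have hmem : ∀ x, h x ∈ LinearMap.range f := fun x => (hfg _).1 (LinearMap.congr_fun hh x)
    refine ⟨(LinearEquiv.ofInjective f hf).symm.toLinearMap ∘ₗ h.codRestrict _ hmem, ?_⟩
    ext x
    change f ((LinearEquiv.ofInjective f hf).symm ⟨h x, hmem x⟩) = h x
    exact congrArg Subtype.val ((LinearEquiv.ofInjective f hf).apply_symm_apply ⟨h x, hmem x⟩)
  · rintro ⟨h, rfl⟩
    ext x
    exact hfg.apply_apply_eq_zero (h x)

/-- The sequence of complexes `Hom_R(X_*, Y₁) → Hom_R(X_*, Y₂) → Hom_R(X_*, Y₃)`. -/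
noncomputable def homShortComplex (f : Y₁ →ₗ[R] Y₂) (g : Y₂ →ₗ[R] Y₃) (hf : Function.Injective f)
    (hfg : Function.Exact f g) : ShortComplex (CochainComplex (ModuleCat.{v} k) ℕ) :=
  sequenceShortComplex (hd := P.homD_comp Y₁) (hd' := P.homD_comp Y₂) (hd'' := P.homD_comp Y₃)
    (fun n => homPostcomp k (P.X n) f) (fun n => homPostcomp k (P.X n) g)
    (fun _ => rfl) (fun _ => rfl) (fun _ => homPostcomp_exact f g hf hfg)

/-- Surjectivity on the right is relative projectivity of the terms of `P`, which applies precisely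
because `g` has a k-linear section. -/
theorem homShortComplex_shortExact (f : Y₁ →ₗ[R] Y₂) (g : Y₂ →ₗ[R] Y₃)
    (hf : Function.Injective f) (hfg : Function.Exact f g) (s : Y₃ →ₗ[k] Y₂)
    (hs : ∀ y, g (s y) = y) : (P.homShortComplex f g hf hfg).ShortExact :=
  sequenceShortComplex_shortExact _ _ _ _ _
    (fun _ _ _ hh => LinearMap.ext fun x => hf (LinearMap.congr_fun hh x))
    (fun n h => P.projective n Y₂ Y₃ g s hs h)

theorem homToExtZero_comp_homologyMap (f : Y₁ →ₗ[R] Y₂) (g : Y₂ →ₗ[R] Y₃)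
    (hf : Function.Injective f) (hfg : Function.Exact f g) :
    P.homToExtZero Y₂ ≫ HomologicalComplex.homologyMap (P.homShortComplex f g hf hfg).g 0 =
      ModuleCat.ofHom (homPostcomp k N g) ≫ P.homToExtZero Y₃ :=
  sequenceClass_comp_homologyMap (hd := P.homD_comp Y₂) (hd' := P.homD_comp Y₃) 0
    (LinearMap.lcomp k Y₂ P.π) _ (LinearMap.lcomp k Y₃ P.π) _ (fun n => homPostcomp k (P.X n) g)
    (fun _ => rfl) (homPostcomp k N g) rfl

end ShortExact

end RelProjResolution

end RelativeExtLemmas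

/-! ### Maps of bimodules and corners -/

section BimoduleMaps

variable {k : Type u} [CommRing k] {A B E : Type v} [Ring A] [Algebra k A] [Ring B] [Algebra k B]
  [Ring E] [Algebra k E] (φ : A →ₙₐ[k] E) (ψ : B →ₙₐ[k] E)
  {X : Type v} [AddCommGroup X] [Module k X] [Module E X] [Module Eᵐᵒᵖ X]
  [IsScalarTower k E X] [IsScalarTower k Eᵐᵒᵖ X] [SMulCommClass E Eᵐᵒᵖ X]
  {Y : Type v} [AddCommGroup Y] [Module k Y] [Module E Y] [Module Eᵐᵒᵖ Y]
  [IsScalarTower k E Y] [IsScalarTower k Eᵐᵒᵖ Y] [SMulCommClass E Eᵐᵒᵖ Y]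
  {Z : Type v} [AddCommGroup Z] [Module k Z] [Module E Z] [Module Eᵐᵒᵖ Z]
  [IsScalarTower k E Z] [IsScalarTower k Eᵐᵒᵖ Z] [SMulCommClass E Eᵐᵒᵖ Z]

variable (E) in
/-- A `k`-linear map is a map of `E`-bimodules. -/
structure IsBimoduleMap (f : X →ₗ[k] Y) : Prop where
  map_smul : ∀ (e : E) (x : X), f (e • x) = e • f x
  map_op_smul : ∀ (e : E) (x : X), f (MulOpposite.op e • x) = MulOpposite.op e • f x

/-- The projection `x ↦ φ(1) x ψ(1)` to the corner. -/
def cornerProj : X →ₗ[k] corner φ ψ X where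
  toFun x := ⟨φ 1 • MulOpposite.op (ψ 1) • x, x, rfl⟩
  map_add' x y := Subtype.ext (by simp)
  map_smul' r x := Subtype.ext (by
    change φ 1 • MulOpposite.op (ψ 1) • r • x = r • φ 1 • MulOpposite.op (ψ 1) • x
    rw [smul_comm (MulOpposite.op (ψ 1)) r x, smul_comm (φ 1) r])

theorem coe_cornerProj (x : X) :
    (cornerProj φ ψ x : X) = φ 1 • MulOpposite.op (ψ 1) • x :=
  rfl

theorem coe_smul_corner (a : A) (y : corner φ ψ X) : ((a • y : corner φ ψ X) : X) = φ a • (y : X) :=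
  rfl

theorem coe_op_smul_corner (b : B) (y : corner φ ψ X) :
    ((MulOpposite.op b • y : corner φ ψ X) : X) = MulOpposite.op (ψ b) • (y : X) :=
  rfl

theorem cornerProj_smul (a : A) (x : X) : cornerProj φ ψ (φ a • x) = a • cornerProj φ ψ x :=
  Subtype.ext (by
    rw [coe_smul_corner, coe_cornerProj, coe_cornerProj, ← smul_comm (φ a), ← mul_smul, ← mul_smul,
      ← map_mul, ← map_mul, one_mul, mul_one])

theorem cornerProj_op_smul (b : B) (x : X) :
    cornerProj φ ψ (MulOpposite.op (ψ b) • x) = MulOpposite.op b • cornerProj φ ψ x :=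
  Subtype.ext (by
    rw [coe_op_smul_corner, coe_cornerProj, coe_cornerProj, ← smul_comm (φ 1), ← mul_smul,
      ← mul_smul, ← MulOpposite.op_mul, ← MulOpposite.op_mul, ← map_mul, ← map_mul, one_mul,
      mul_one])

theorem cornerProj_coe (y : corner φ ψ X) : cornerProj φ ψ (y : X) = y :=
  Subtype.ext (by rw [coe_cornerProj, op_one_smul_corner φ ψ y.2, one_smul_corner φ ψ y.2])

/-- A map of bimodules restricts to corners. -/
def cornerMap (f : X →ₗ[k] Y) (hf : IsBimoduleMap E f) : corner φ ψ X →ₗ[k] corner φ ψ Y :=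
  f.restrict (by
    rintro _ ⟨x, rfl⟩
    exact ⟨f x, by rw [hf.map_smul, hf.map_op_smul]⟩)

theorem coe_cornerMap (f : X →ₗ[k] Y) (hf : IsBimoduleMap E f) (y : corner φ ψ X) :
    (cornerMap φ ψ f hf y : Y) = f y :=
  rfl

theorem cornerMap_cornerProj (f : X →ₗ[k] Y) (hf : IsBimoduleMap E f) (x : X) :
    cornerMap φ ψ f hf (cornerProj φ ψ x) = cornerProj φ ψ (f x) :=
  Subtype.ext (by
    rw [coe_cornerMap, coe_cornerProj, coe_cornerProj, hf.map_smul, hf.map_op_smul])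

theorem cornerMap_smul (f : X →ₗ[k] Y) (hf : IsBimoduleMap E f) (a : A) (y : corner φ ψ X) :
    cornerMap φ ψ f hf (a • y) = a • cornerMap φ ψ f hf y :=
  Subtype.ext (hf.map_smul (φ a) y)

theorem cornerMap_op_smul (f : X →ₗ[k] Y) (hf : IsBimoduleMap E f) (b : Bᵐᵒᵖ)
    (y : corner φ ψ X) : cornerMap φ ψ f hf (b • y) = b • cornerMap φ ψ f hf y :=
  Subtype.ext (hf.map_op_smul (ψ b.unop) y)

theorem cornerMap_injective (f : X →ₗ[k] Y) (hf : IsBimoduleMap E f) (h : Function.Injective f) :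
    Function.Injective (cornerMap φ ψ f hf) := fun _ _ hxy =>
  Subtype.ext (h (congrArg Subtype.val hxy))

/-- Cutting by idempotents is exact: a preimage of an element of the corner may be projected to the
corner, since the projection commutes with bimodule maps. -/
theorem cornerMap_exact (f : X →ₗ[k] Y) (hf : IsBimoduleMap E f) (g : Y →ₗ[k] Z)
    (hg : IsBimoduleMap E g) (h : Function.Exact f g) :
    Function.Exact (cornerMap φ ψ f hf) (cornerMap φ ψ g hg) := by
  intro y
  constructor
  · intro hy
    obtain ⟨x, hx⟩ := (h (y : Y)).1 (congrArg Subtype.val hy)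
    refine ⟨cornerProj φ ψ x, ?_⟩
    rw [cornerMap_cornerProj, hx, cornerProj_coe]
  · rintro ⟨x, rfl⟩
    exact Subtype.ext (h.apply_apply_eq_zero (x : X))

/-- A k-linear section does not preserve corners, but it does after projection. Thus corners of a
k-split sequence form a k-split sequence, as relative Ext requires. -/
theorem cornerMap_section (g : Y →ₗ[k] Z) (hg : IsBimoduleMap E g) (s : Z →ₗ[k] Y)
    (hs : ∀ z, g (s z) = z) (z : corner φ ψ Z) :
    cornerMap φ ψ g hg ((cornerProj φ ψ ∘ₗ s ∘ₗ (corner φ ψ Z).subtype) z) = z := by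
  simp only [LinearMap.comp_apply, Submodule.subtype_apply]
  rw [cornerMap_cornerProj, hs, cornerProj_coe]

end BimoduleMaps

/-! ### Bimodule maps as linear maps over the tensor product -/

section BimoduleLinearMap

variable {k : Type u} {A B : Type v} [CommRing k] [Ring A] [Algebra k A] [Ring B] [Algebra k B]
  {M : Type v} [AddCommGroup M] [Module k M] [Module A M] [Module Bᵐᵒᵖ M]
  [IsScalarTower k A M] [IsScalarTower k Bᵐᵒᵖ M] [SMulCommClass A Bᵐᵒᵖ M]
  {Y : Type v} [AddCommGroup Y] [Module k Y] [Module A Y] [Module Bᵐᵒᵖ Y]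
  [IsScalarTower k A Y] [IsScalarTower k Bᵐᵒᵖ Y] [SMulCommClass A Bᵐᵒᵖ Y]

attribute [local instance] TensorProduct.Algebra.module isScalarTower_tensorProduct_op

/-- A map of `(A, B)`-bimodules is linear over `A ⊗ Bᵒᵖ`. -/
def tensorLinearMap (f : M →ₗ[k] Y) (hA : ∀ (a : A) m, f (a • m) = a • f m)
    (hB : ∀ (b : Bᵐᵒᵖ) m, f (b • m) = b • f m) : M →ₗ[A ⊗[k] Bᵐᵒᵖ] Y where
  toFun := f
  map_add' := map_add f
  map_smul' r m := by
    induction r with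
    | zero =>
      exact (congrArg f (zero_smul (A ⊗[k] Bᵐᵒᵖ) m)).trans
        ((map_zero f).trans (zero_smul (A ⊗[k] Bᵐᵒᵖ) (f m)).symm)
    | tmul a b => simp [TensorProduct.Algebra.smul_def, hA, hB]
    | add r s hr hs => simp_all [add_smul]

theorem tensorLinearMap_smul (g : M →ₗ[A ⊗[k] Bᵐᵒᵖ] Y) (a : A) (m : M) :
    g (a • m) = a • g m := by
  have := map_smul g (a ⊗ₜ[k] (1 : Bᵐᵒᵖ)) m
  simpa [TensorProduct.Algebra.smul_def] using this

theorem tensorLinearMap_op_smul (g : M →ₗ[A ⊗[k] Bᵐᵒᵖ] Y) (b : Bᵐᵒᵖ) (m : M) :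
    g (b • m) = b • g m := by
  have := map_smul g ((1 : A) ⊗ₜ[k] b) m
  simpa [TensorProduct.Algebra.smul_def] using this

end BimoduleLinearMap

/-! ### Cochains that vanish on the diagonal of the triangular algebra -/

namespace TriangularAlgebra

/-! ### Matrix entries of the triangular algebra -/

section Elements

variable {k : Type u} {A M B : Type v} [CommRing k] [Ring A] [Algebra k A] [Ring B] [Algebra k B]
  [AddCommGroup M] [Module k M] [Module A M] [Module Bᵐᵒᵖ M]
  [IsScalarTower k A M] [IsScalarTower k Bᵐᵒᵖ M] [SMulCommClass A Bᵐᵒᵖ M]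

variable (k A M B)

/-- The projection to the left upper corner. -/
def projA : TriangularAlgebra A M B →ₗ[k] A where
  toFun := TriangularAlgebra.a
  map_add' _ _ := rfl
  map_smul' _ _ := rfl

/-- The projection to the right lower corner. -/
def projB : TriangularAlgebra A M B →ₗ[k] B where
  toFun := TriangularAlgebra.b
  map_add' _ _ := rfl
  map_smul' _ _ := rfl

/-- The projection to the right upper corner. -/
def projM : TriangularAlgebra A M B →ₗ[k] M where
  toFun := TriangularAlgebra.m
  map_add' _ _ := rfl
  map_smul' _ _ := rfl

/-- The inclusion of the right upper corner. -/
def inM : M →ₗ[k] TriangularAlgebra A M B where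
  toFun m := ⟨0, m, 0⟩
  map_add' x y := by ext <;> simp
  map_smul' r x := by ext <;> simp

variable {k A M B}

@[simp] theorem projM_apply (x : TriangularAlgebra A M B) : projM k A M B x = x.m := rfl
@[simp] theorem inM_apply_a (m : M) : (inM k A M B m).a = 0 := rfl
@[simp] theorem inM_apply_m (m : M) : (inM k A M B m).m = m := rfl
@[simp] theorem inM_apply_b (m : M) : (inM k A M B m).b = 0 := rfl
@[simp] theorem inA_apply_a (a : A) : (inA k A M B a).a = a := rfl
@[simp] theorem inA_apply_m (a : A) : (inA k A M B a).m = 0 := rfl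
@[simp] theorem inA_apply_b (a : A) : (inA k A M B a).b = 0 := rfl
@[simp] theorem inB_apply_a (b : B) : (inB k A M B b).a = 0 := rfl
@[simp] theorem inB_apply_m (b : B) : (inB k A M B b).m = 0 := rfl
@[simp] theorem inB_apply_b (b : B) : (inB k A M B b).b = b := rfl

theorem inA_one_mul_inB_one : inA k A M B 1 * inB k A M B 1 = 0 := by ext <;> simp
theorem inB_one_mul_inA_one : inB k A M B 1 * inA k A M B 1 = 0 := by ext <;> simp
theorem inA_one_add_inB_one : inA k A M B 1 + inB k A M B 1 = 1 := by ext <;> simp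

theorem eq_inA_add_inM_add_inB (x : TriangularAlgebra A M B) :
    x = inA k A M B x.a + inM k A M B x.m + inB k A M B x.b := by ext <;> simp

end Elements

variable {k : Type u} {A M B : Type v} [CommRing k] [Ring A] [Algebra k A] [Ring B] [Algebra k B]
  [AddCommGroup M] [Module k M] [Module A M] [Module Bᵐᵒᵖ M]
  [IsScalarTower k A M] [IsScalarTower k Bᵐᵒᵖ M] [SMulCommClass A Bᵐᵒᵖ M]
  {X : Type v} [AddCommGroup X] [Module k X]
  [Module (TriangularAlgebra A M B) X] [Module (TriangularAlgebra A M B)ᵐᵒᵖ X]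
  [IsScalarTower k (TriangularAlgebra A M B) X] [IsScalarTower k (TriangularAlgebra A M B)ᵐᵒᵖ X]
  [SMulCommClass (TriangularAlgebra A M B) (TriangularAlgebra A M B)ᵐᵒᵖ X]
  {Y : Type v} [AddCommGroup Y] [Module k Y]
  [Module (TriangularAlgebra A M B) Y] [Module (TriangularAlgebra A M B)ᵐᵒᵖ Y]
  [IsScalarTower k (TriangularAlgebra A M B) Y] [IsScalarTower k (TriangularAlgebra A M B)ᵐᵒᵖ Y]
  [SMulCommClass (TriangularAlgebra A M B) (TriangularAlgebra A M B)ᵐᵒᵖ Y]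
  {Z : Type v} [AddCommGroup Z] [Module k Z]
  [Module (TriangularAlgebra A M B) Z] [Module (TriangularAlgebra A M B)ᵐᵒᵖ Z]
  [IsScalarTower k (TriangularAlgebra A M B) Z] [IsScalarTower k (TriangularAlgebra A M B)ᵐᵒᵖ Z]
  [SMulCommClass (TriangularAlgebra A M B) (TriangularAlgebra A M B)ᵐᵒᵖ Z]

local notation "E" => TriangularAlgebra A M B
local notation "eA" => inA k A M B 1
local notation "eB" => inB k A M B 1

variable (k A M B X)

/-- Restriction of cochains to the diagonal. -/
def diagRestrict (n : ℕ) : HochschildCochain k E X n →ₗ[k]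
    HochschildCochain k A (XAA k A M B X) n × HochschildCochain k B (XBB k A M B X) n :=
  (hochschildMap (inA k A M B : A →ₗ[k] E) (cornerProj _ _) n).prod
    (hochschildMap (inB k A M B : B →ₗ[k] E) (cornerProj _ _) n)

/-- Extension of cochains on the diagonal by zero. -/
def diagExtend (n : ℕ) :
    HochschildCochain k A (XAA k A M B X) n × HochschildCochain k B (XBB k A M B X) n →ₗ[k]
      HochschildCochain k E X n :=
  (hochschildMap (projA k A M B) (XAA k A M B X).subtype n).coprod
    (hochschildMap (projB k A M B) (XBB k A M B X).subtype n)

variable {k A M B X}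

theorem diagRestrict_apply_fst (n : ℕ) (f : HochschildCochain k E X n) (c : Fin n → A) :
    (((diagRestrict k A M B X n f).1 c : XAA k A M B X) : X) =
      eA • MulOpposite.op eA • f (fun i => inA k A M B (c i)) :=
  rfl

theorem diagRestrict_apply_snd (n : ℕ) (f : HochschildCochain k E X n) (c : Fin n → B) :
    (((diagRestrict k A M B X n f).2 c : XBB k A M B X) : X) =
      eB • MulOpposite.op eB • f (fun i => inB k A M B (c i)) :=
  rfl

theorem diagExtend_apply (n : ℕ)
    (f : HochschildCochain k A (XAA k A M B X) n × HochschildCochain k B (XBB k A M B X) n)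
    (c : Fin n → E) :
    diagExtend k A M B X n f c = (f.1 (fun i => (c i).a) : X) + (f.2 (fun i => (c i).b) : X) :=
  rfl

theorem eA_smul_XBB (y : XBB k A M B X) : eA • (y : X) = 0 := by
  rw [← one_smul_corner _ _ y.2, ← mul_smul, inA_one_mul_inB_one, zero_smul]

theorem eB_smul_XAA (y : XAA k A M B X) : eB • (y : X) = 0 := by
  rw [← one_smul_corner _ _ y.2, ← mul_smul, inB_one_mul_inA_one, zero_smul]

/-- The idempotents 1_A and 1_B are orthogonal, so each kills the corner of the other and the cross
terms vanish. This section is used degreewise only; it need not commute with the differentials. -/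
theorem diagRestrict_diagExtend (n : ℕ)
    (f : HochschildCochain k A (XAA k A M B X) n × HochschildCochain k B (XBB k A M B X) n) :
    diagRestrict k A M B X n (diagExtend k A M B X n f) = f := by
  refine Prod.ext (MultilinearMap.ext fun c => Subtype.ext ?_)
    (MultilinearMap.ext fun c => Subtype.ext ?_)
  · rw [diagRestrict_apply_fst, diagExtend_apply, smul_comm eA, smul_add, eA_smul_XBB, add_zero,
      one_smul_corner _ _ (f.1 _).2, op_one_smul_corner _ _ (f.1 _).2]
    rfl
  · rw [diagRestrict_apply_snd, diagExtend_apply, smul_comm eB, smul_add, eB_smul_XAA, zero_add,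
      one_smul_corner _ _ (f.2 _).2, op_one_smul_corner _ _ (f.2 _).2]
    rfl

theorem prodMap_hochschildD_comp_diagRestrict (n : ℕ) :
    (hochschildD k A (XAA k A M B X) n).prodMap (hochschildD k B (XBB k A M B X) n) ∘ₗ
        diagRestrict k A M B X n =
      diagRestrict k A M B X (n + 1) ∘ₗ hochschildD k E X n := by
  have hA := hochschildD_comp_hochschildMap (inA k A M B : A →ₗ[k] E)
    (cornerProj (X := X) (inA k A M B) (inA k A M B)) (map_mul (inA k A M B))
    (cornerProj_smul _ _) (cornerProj_op_smul _ _) n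
  have hB := hochschildD_comp_hochschildMap (inB k A M B : B →ₗ[k] E)
    (cornerProj (X := X) (inB k A M B) (inB k A M B)) (map_mul (inB k A M B))
    (cornerProj_smul _ _) (cornerProj_op_smul _ _) n
  exact LinearMap.ext fun f => Prod.ext (LinearMap.congr_fun hA f) (LinearMap.congr_fun hB f)

variable (k A M B X)

/-- The cochains whose restriction to the diagonal vanishes. -/
abbrev OffDiagCochain (n : ℕ) : Type v := LinearMap.ker (diagRestrict k A M B X n)

/-- The Hochschild differential on cochains whose restriction to the diagonal vanishes. -/
def offDiagD (n : ℕ) : OffDiagCochain k A M B X n →ₗ[k] OffDiagCochain k A M B X (n + 1) :=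
  (hochschildD k E X n).restrict fun f hf => by
    rw [LinearMap.mem_ker] at hf ⊢
    have := LinearMap.congr_fun (prodMap_hochschildD_comp_diagRestrict (X := X) n) f
    rw [LinearMap.comp_apply, hf, map_zero] at this
    exact this.symm

theorem offDiagD_comp (n : ℕ) : offDiagD k A M B X (n + 1) ∘ₗ offDiagD k A M B X n = 0 :=
  LinearMap.ext fun f => Subtype.ext (LinearMap.congr_fun (hochschildD_comp k E X n) (f : _))

/-- The complex of cochains whose restriction to the diagonal vanishes. -/
noncomputable abbrev offDiagComplex : CochainComplex (ModuleCat.{v} k) ℕ :=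
  sequenceComplex (offDiagD k A M B X) (offDiagD_comp k A M B X)

/-- The sequence of complexes given by restriction to the diagonal. -/
noncomputable def diagShortComplex : ShortComplex (CochainComplex (ModuleCat.{v} k) ℕ) :=
  sequenceShortComplex (hd := offDiagD_comp k A M B X) (hd' := hochschildD_comp k E X)
    (hd'' := fun n => prodMap_comp_eq_zero n (hochschildD_comp k A (XAA k A M B X))
      (hochschildD_comp k B (XBB k A M B X)))
    (fun n => (LinearMap.ker (diagRestrict k A M B X n)).subtype) (diagRestrict k A M B X)
    (fun _ => rfl) prodMap_hochschildD_comp_diagRestrict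
    (fun n => (diagRestrict k A M B X n).exact_subtype_ker_map)

theorem diagShortComplex_shortExact : (diagShortComplex k A M B X).ShortExact :=
  sequenceShortComplex_shortExact _ _ _ _ _ (fun _ => Subtype.val_injective)
    (fun n f => ⟨diagExtend k A M B X n f, diagRestrict_diagExtend n f⟩)

/-! ### Dependence of the off-diagonal complex on the coefficients -/

variable {k A M B X}

theorem diagRestrict_hochschildMap_id (f : X →ₗ[k] Y) (hf : IsBimoduleMap E f) (n : ℕ)
    (g : HochschildCochain k E X n) :
    diagRestrict k A M B Y n (hochschildMap LinearMap.id f n g) =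
      Prod.map (hochschildMap LinearMap.id (cornerMap _ _ f hf) n)
        (hochschildMap LinearMap.id (cornerMap _ _ f hf) n) (diagRestrict k A M B X n g) :=
  Prod.ext (MultilinearMap.ext fun _ => (cornerMap_cornerProj _ _ f hf _).symm)
    (MultilinearMap.ext fun _ => (cornerMap_cornerProj _ _ f hf _).symm)

/-- Functoriality in the coefficients. -/
def offDiagMap (f : X →ₗ[k] Y) (hf : IsBimoduleMap E f) (n : ℕ) :
    OffDiagCochain k A M B X n →ₗ[k] OffDiagCochain k A M B Y n :=
  (hochschildMap LinearMap.id f n).restrict fun g hg => by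
    rw [LinearMap.mem_ker] at hg ⊢
    rw [diagRestrict_hochschildMap_id f hf, hg]
    exact Prod.ext (map_zero _) (map_zero _)

theorem offDiagD_comp_offDiagMap (f : X →ₗ[k] Y) (hf : IsBimoduleMap E f) (n : ℕ) :
    offDiagD k A M B Y n ∘ₗ offDiagMap f hf n = offDiagMap f hf (n + 1) ∘ₗ offDiagD k A M B X n :=
  LinearMap.ext fun g => Subtype.ext (LinearMap.congr_fun
    (hochschildD_comp_hochschildMap LinearMap.id f (fun _ _ => rfl) hf.map_smul hf.map_op_smul n)
    (g : HochschildCochain k E X n))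

theorem offDiagMap_injective (f : X →ₗ[k] Y) (hf : IsBimoduleMap E f) (h : Function.Injective f)
    (n : ℕ) : Function.Injective (offDiagMap f hf n) := fun _ _ hgg' =>
  Subtype.ext (MultilinearMap.ext fun c =>
    h (DFunLike.congr_fun (congrArg Subtype.val hgg') c))

/-- A lift through the k-linear section may have a nonzero diagonal part. Subtracting the zero
extension of that part repairs it and leaves the image unchanged, because the image has zero
diagonal part. -/
theorem offDiagMap_surjective (g : Y →ₗ[k] Z) (hg : IsBimoduleMap E g) (s : Z →ₗ[k] Y)
    (hs : ∀ z, g (s z) = z) (n : ℕ) : Function.Surjective (offDiagMap g hg n) := by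
  intro f
  let F : HochschildCochain k E Y n := hochschildMap LinearMap.id s n f.1
  have hF : hochschildMap LinearMap.id g n F = f.1 := by
    ext c
    exact hs _
  have hr := diagRestrict_hochschildMap_id g hg n F
  rw [hF, f.2] at hr
  refine ⟨⟨F - diagExtend k A M B Y n (diagRestrict k A M B Y n F), ?_⟩, Subtype.ext ?_⟩
  · rw [LinearMap.mem_ker, map_sub, diagRestrict_diagExtend, sub_self]
  · change hochschildMap LinearMap.id g n (F - _) = f.1
    rw [map_sub, hF, sub_eq_self]
    ext c
    have h₁ := DFunLike.congr_fun (congrArg Prod.fst hr) fun i => (c i).a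
    have h₂ := DFunLike.congr_fun (congrArg Prod.snd hr) fun i => (c i).b
    rw [hochschildMap_apply, diagExtend_apply, map_add]
    exact (congrArg₂ (· + ·) (congrArg Subtype.val h₁).symm (congrArg Subtype.val h₂).symm).trans
      (add_zero 0)

theorem offDiagMap_exact (f : X →ₗ[k] Y) (hf : IsBimoduleMap E f) (g : Y →ₗ[k] Z)
    (hg : IsBimoduleMap E g) (hinj : Function.Injective f) (h : Function.Exact f g) (n : ℕ) :
    Function.Exact (offDiagMap f hf n) (offDiagMap g hg n) := by
  intro F
  constructor
  · intro hF
    have hmem : ∀ c, F.1 c ∈ LinearMap.range f := fun c =>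
      (h _).1 (DFunLike.congr_fun (congrArg Subtype.val hF) c)
    let G : HochschildCochain k E X n :=
      (LinearEquiv.ofInjective f hinj).symm.toLinearMap.compMultilinearMap
        (F.1.codRestrict _ hmem)
    have hG : hochschildMap LinearMap.id f n G = F.1 := by
      ext c
      exact congrArg Subtype.val ((LinearEquiv.ofInjective f hinj).apply_symm_apply ⟨F.1 c, hmem c⟩)
    have hr := diagRestrict_hochschildMap_id f hf n G
    rw [hG, F.2] at hr
    refine ⟨⟨G, ?_⟩, Subtype.ext hG⟩
    -- The preimage `G` is off-diagonal because `f` is injective on the diagonal corners and sends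
    -- the diagonal part of `G` to that of `F`, which is zero.
    refine Prod.ext (MultilinearMap.ext fun c => ?_) (MultilinearMap.ext fun c => ?_)
    · refine cornerMap_injective _ _ f hf hinj
        ((DFunLike.congr_fun (congrArg Prod.fst hr) c).symm.trans ?_)
      exact (map_zero _).symm
    · refine cornerMap_injective _ _ f hf hinj
        ((DFunLike.congr_fun (congrArg Prod.snd hr) c).symm.trans ?_)
      exact (map_zero _).symm
  · rintro ⟨G, rfl⟩
    exact Subtype.ext (MultilinearMap.ext fun c => h.apply_apply_eq_zero (G.1 c))

/-- The sequence of complexes induced by a sequence of bimodules. -/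
noncomputable def offDiagShortComplex (f : X →ₗ[k] Y) (hf : IsBimoduleMap E f) (g : Y →ₗ[k] Z)
    (hg : IsBimoduleMap E g) (hinj : Function.Injective f) (h : Function.Exact f g) :
    ShortComplex (CochainComplex (ModuleCat.{v} k) ℕ) :=
  sequenceShortComplex (hd := offDiagD_comp k A M B X) (hd' := offDiagD_comp k A M B Y)
    (hd'' := offDiagD_comp k A M B Z) (offDiagMap f hf) (offDiagMap g hg)
    (offDiagD_comp_offDiagMap f hf) (offDiagD_comp_offDiagMap g hg)
    (offDiagMap_exact f hf g hg hinj h)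

theorem offDiagShortComplex_shortExact (f : X →ₗ[k] Y) (hf : IsBimoduleMap E f) (g : Y →ₗ[k] Z)
    (hg : IsBimoduleMap E g) (hinj : Function.Injective f) (h : Function.Exact f g)
    (s : Z →ₗ[k] Y) (hs : ∀ z, g (s z) = z) :
    (offDiagShortComplex f hf g hg hinj h).ShortExact :=
  sequenceShortComplex_shortExact _ _ _ _ _ (offDiagMap_injective f hf hinj)
    (offDiagMap_surjective g hg s hs)

end TriangularAlgebra

/-! ### Embedding a bimodule in a coinduced one -/

section Coinduced

variable (k : Type u) [CommRing k] (C : Type v) [Ring C] [Algebra k C]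

/-- The `C`-bimodule of `k`-bilinear maps `F : C × C → V`, with
`(c F c')(x, y) = F(x c, c' y)`. -/
def CoinducedBimodule (V : Type v) [AddCommGroup V] [Module k V] : Type v :=
  C →ₗ[k] C →ₗ[k] V

namespace CoinducedBimodule

variable {k C} {V : Type v} [AddCommGroup V] [Module k V]

instance : AddCommGroup (CoinducedBimodule k C V) :=
  inferInstanceAs (AddCommGroup (C →ₗ[k] C →ₗ[k] V))

instance : Module k (CoinducedBimodule k C V) := inferInstanceAs (Module k (C →ₗ[k] C →ₗ[k] V))

/-- The value of a bilinear map. -/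
def eval (F : CoinducedBimodule k C V) (x y : C) : V :=
  (show C →ₗ[k] C →ₗ[k] V from F) x y

@[ext] theorem ext {F G : CoinducedBimodule k C V} (h : ∀ x y, F.eval x y = G.eval x y) : F = G :=
  LinearMap.ext₂ h

@[simp] theorem eval_add (F G : CoinducedBimodule k C V) (x y : C) :
    (F + G).eval x y = F.eval x y + G.eval x y := rfl

@[simp] theorem eval_zero (x y : C) : (0 : CoinducedBimodule k C V).eval x y = 0 := rfl

@[simp] theorem eval_smul (r : k) (F : CoinducedBimodule k C V) (x y : C) :
    (r • F).eval x y = r • F.eval x y := rfl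

@[simp] theorem eval_add_left (F : CoinducedBimodule k C V) (x x' y : C) :
    F.eval (x + x') y = F.eval x y + F.eval x' y :=
  LinearMap.map_add₂ (show C →ₗ[k] C →ₗ[k] V from F) x x' y

@[simp] theorem eval_add_right (F : CoinducedBimodule k C V) (x y y' : C) :
    F.eval x (y + y') = F.eval x y + F.eval x y' :=
  map_add ((show C →ₗ[k] C →ₗ[k] V from F) x) y y'

@[simp] theorem eval_smul_left (F : CoinducedBimodule k C V) (r : k) (x y : C) :
    F.eval (r • x) y = r • F.eval x y :=
  LinearMap.map_smul₂ (show C →ₗ[k] C →ₗ[k] V from F) r x y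

@[simp] theorem eval_smul_right (F : CoinducedBimodule k C V) (r : k) (x y : C) :
    F.eval x (r • y) = r • F.eval x y :=
  map_smul ((show C →ₗ[k] C →ₗ[k] V from F) x) r y

@[simp] theorem eval_zero_left (F : CoinducedBimodule k C V) (y : C) : F.eval 0 y = 0 :=
  LinearMap.map_zero₂ (show C →ₗ[k] C →ₗ[k] V from F) y

@[simp] theorem eval_zero_right (F : CoinducedBimodule k C V) (x : C) : F.eval x 0 = 0 :=
  map_zero ((show C →ₗ[k] C →ₗ[k] V from F) x)

/-- A bilinear map, as an element of the coinduced bimodule. -/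
def mk (F : C → C → V) (h₁ : ∀ x x' y, F (x + x') y = F x y + F x' y)
    (h₂ : ∀ (r : k) x y, F (r • x) y = r • F x y) (h₃ : ∀ x y y', F x (y + y') = F x y + F x y')
    (h₄ : ∀ (r : k) x y, F x (r • y) = r • F x y) : CoinducedBimodule k C V :=
  LinearMap.mk₂ k F h₁ h₂ h₃ h₄

@[simp] theorem eval_mk (F : C → C → V) (h₁ : ∀ x x' y, F (x + x') y = F x y + F x' y)
    (h₂ : ∀ (r : k) x y, F (r • x) y = r • F x y) (h₃ : ∀ x y y', F x (y + y') = F x y + F x y')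
    (h₄ : ∀ (r : k) x y, F x (r • y) = r • F x y) (x y : C) :
    (mk F h₁ h₂ h₃ h₄).eval x y = F x y := rfl

instance : SMul C (CoinducedBimodule k C V) where
  smul c F := mk (fun x y => F.eval (x * c) y) (by simp [add_mul]) (by simp) (by simp) (by simp)

instance : SMul Cᵐᵒᵖ (CoinducedBimodule k C V) where
  smul c F := mk (fun x y => F.eval x (c.unop * y)) (by simp) (by simp) (by simp [mul_add])
    (by simp)

@[simp] theorem eval_left_smul (c : C) (F : CoinducedBimodule k C V) (x y : C) :
    (c • F).eval x y = F.eval (x * c) y := rfl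

@[simp] theorem eval_right_smul (c : Cᵐᵒᵖ) (F : CoinducedBimodule k C V) (x y : C) :
    (c • F).eval x y = F.eval x (c.unop * y) := rfl

instance : Module C (CoinducedBimodule k C V) where
  one_smul F := by ext; simp
  mul_smul c c' F := by ext; simp [mul_assoc]
  smul_zero c := by ext; simp
  smul_add c F G := by ext; simp
  add_smul c c' F := by ext; simp [mul_add]
  zero_smul F := by ext; simp

instance : Module Cᵐᵒᵖ (CoinducedBimodule k C V) where
  one_smul F := by ext; simp
  mul_smul c c' F := by ext; simp [mul_assoc]
  smul_zero c := by ext; simp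
  smul_add c F G := by ext; simp
  add_smul c c' F := by ext; simp [add_mul]
  zero_smul F := by ext; simp

instance : IsScalarTower k C (CoinducedBimodule k C V) where
  smul_assoc r c F := by ext; simp

instance : IsScalarTower k Cᵐᵒᵖ (CoinducedBimodule k C V) where
  smul_assoc r c F := by ext; simp

instance : SMulCommClass C Cᵐᵒᵖ (CoinducedBimodule k C V) where
  smul_comm c c' F := by ext; simp

/-- The value at `(1, 1)`. -/
def evalOne : CoinducedBimodule k C V →ₗ[k] V where
  toFun F := F.eval 1 1
  map_add' _ _ := rfl
  map_smul' _ _ := rfl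

section Unit

variable {X : Type v} [AddCommGroup X] [Module k X] [Module C X] [Module Cᵐᵒᵖ X]
  [IsScalarTower k C X] [IsScalarTower k Cᵐᵒᵖ X] [SMulCommClass C Cᵐᵒᵖ X]

variable (k C X)

/-- The embedding of a bimodule `X` which sends `z` to `(x, y) ↦ x z y`. -/
def unit : X →ₗ[k] CoinducedBimodule k C X where
  toFun z := mk (fun x y => x • MulOpposite.op y • z)
    (by simp [add_smul]) (by simp) (by simp [add_smul])
    (fun r x y => by rw [MulOpposite.op_smul, smul_assoc, smul_comm x r])
  map_add' z z' := by ext; simp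
  map_smul' r z := by
    ext x y
    simp only [eval_mk, eval_smul, RingHom.id_apply]
    rw [smul_comm (MulOpposite.op y) r z, smul_comm x r]

variable {k C X}

@[simp] theorem eval_unit (z : X) (x y : C) : (unit k C X z).eval x y = x • MulOpposite.op y • z :=
  rfl

theorem isBimoduleMap_unit : IsBimoduleMap C (unit k C X) where
  map_smul c z := by
    ext x y
    simp only [eval_unit, eval_left_smul]
    rw [← smul_comm c, mul_smul]
  map_op_smul c z := by
    ext x y
    simp only [eval_unit, eval_right_smul, MulOpposite.op_mul, mul_smul, MulOpposite.unop_op]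

/-- A k-linear retraction of the embedding, in general not a bimodule map. It is what makes the
sequence of coefficients split over k. -/
theorem evalOne_unit (z : X) : evalOne (unit k C X z) = z := by
  change (1 : C) • MulOpposite.op (1 : C) • z = z
  simp

theorem unit_injective : Function.Injective (unit k C X) :=
  Function.LeftInverse.injective evalOne_unit

end Unit

end CoinducedBimodule

end Coinduced

section Quotient

variable {k : Type u} [CommRing k] {S : Type*} [Ring S] {I : Type*} [AddCommGroup I] [Module k I]
  [Module S I] [SMulCommClass S k I] (p : Submodule k I)

/-- The action on the quotient by a stable submodule. -/
def Submodule.quotientAction (hp : ∀ (s : S), ∀ x ∈ p, s • x ∈ p) : S →+* Module.End k (I ⧸ p) where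
  toFun s := p.mapQ p (Module.toModuleEnd k I s) (hp s)
  map_one' := Submodule.linearMap_qext _ (by ext; simp)
  map_mul' s t := Submodule.linearMap_qext _ (by ext; simp [mul_smul])
  map_zero' := Submodule.linearMap_qext _ (by ext; simp)
  map_add' s t := Submodule.linearMap_qext _ (by ext; simp [add_smul])

end Quotient

/-! ### The cokernel of the coinduced embedding -/

section Cosyzygy

variable (k : Type u) [CommRing k] (C : Type v) [Ring C] [Algebra k C]
  (X : Type v) [AddCommGroup X] [Module k X] [Module C X] [Module Cᵐᵒᵖ X]
  [IsScalarTower k C X] [IsScalarTower k Cᵐᵒᵖ X] [SMulCommClass C Cᵐᵒᵖ X]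

/-- The cokernel of the embedding of a bimodule in a coinduced one. -/
def Cosyzygy : Type v := CoinducedBimodule k C X ⧸ LinearMap.range (CoinducedBimodule.unit k C X)

namespace Cosyzygy

instance : AddCommGroup (Cosyzygy k C X) :=
  inferInstanceAs (AddCommGroup (_ ⧸ LinearMap.range (CoinducedBimodule.unit k C X)))

instance : Module k (Cosyzygy k C X) :=
  inferInstanceAs (Module k (_ ⧸ LinearMap.range (CoinducedBimodule.unit k C X)))

/-- The projection to the cokernel. -/
def proj : CoinducedBimodule k C X →ₗ[k] Cosyzygy k C X :=
  (LinearMap.range (CoinducedBimodule.unit k C X)).mkQ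

variable {k C X}

theorem proj_surjective : Function.Surjective (proj k C X) :=
  Submodule.mkQ_surjective _

theorem exact_unit_proj : Function.Exact (CoinducedBimodule.unit k C X) (proj k C X) :=
  LinearMap.exact_map_mkQ_range _

theorem smul_mem_range_unit (c : C) :
    ∀ F ∈ LinearMap.range (CoinducedBimodule.unit k C X),
      c • F ∈ LinearMap.range (CoinducedBimodule.unit k C X) := by
  rintro _ ⟨x, rfl⟩
  exact ⟨c • x, CoinducedBimodule.isBimoduleMap_unit.map_smul c x⟩

theorem op_smul_mem_range_unit (c : Cᵐᵒᵖ) :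
    ∀ F ∈ LinearMap.range (CoinducedBimodule.unit k C X),
      c • F ∈ LinearMap.range (CoinducedBimodule.unit k C X) := by
  rintro _ ⟨x, rfl⟩
  exact ⟨c • x, CoinducedBimodule.isBimoduleMap_unit.map_op_smul c.unop x⟩

instance : Module C (Cosyzygy k C X) :=
  Module.compHom (_ ⧸ LinearMap.range (CoinducedBimodule.unit k C X))
    (Submodule.quotientAction _ (smul_mem_range_unit (k := k) (C := C) (X := X)))

instance : Module Cᵐᵒᵖ (Cosyzygy k C X) :=
  Module.compHom (_ ⧸ LinearMap.range (CoinducedBimodule.unit k C X))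
    (Submodule.quotientAction _ (op_smul_mem_range_unit (k := k) (C := C) (X := X)))

theorem proj_smul (c : C) (F : CoinducedBimodule k C X) : proj k C X (c • F) = c • proj k C X F :=
  rfl

theorem proj_op_smul (c : Cᵐᵒᵖ) (F : CoinducedBimodule k C X) :
    proj k C X (c • F) = c • proj k C X F :=
  rfl

theorem isBimoduleMap_proj : IsBimoduleMap C (proj k C X) where
  map_smul := proj_smul
  map_op_smul c := proj_op_smul (MulOpposite.op c)

instance : IsScalarTower k C (Cosyzygy k C X) where
  smul_assoc r c z := by
    obtain ⟨F, rfl⟩ := proj_surjective z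
    rw [← proj_smul, ← proj_smul, ← map_smul, smul_assoc]

instance : IsScalarTower k Cᵐᵒᵖ (Cosyzygy k C X) where
  smul_assoc r c z := by
    obtain ⟨F, rfl⟩ := proj_surjective z
    rw [← proj_op_smul, ← proj_op_smul, ← map_smul, smul_assoc]

instance : SMulCommClass C Cᵐᵒᵖ (Cosyzygy k C X) where
  smul_comm c c' z := by
    obtain ⟨F, rfl⟩ := proj_surjective z
    rw [← proj_op_smul, ← proj_smul, ← proj_smul, ← proj_op_smul, smul_comm]

variable (k C X) in
-- The endomorphism F ↦ F - unit(F(1, 1)) kills the image of the embedding and is the identity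
-- modulo it, so it descends to a section.
theorem exists_section : ∃ s : Cosyzygy k C X →ₗ[k] CoinducedBimodule k C X,
    ∀ z, proj k C X (s z) = z := by
  refine ⟨(LinearMap.range (CoinducedBimodule.unit k C X)).liftQ
    (LinearMap.id - CoinducedBimodule.unit k C X ∘ₗ CoinducedBimodule.evalOne) ?_, fun z => ?_⟩
  · rintro _ ⟨x, rfl⟩
    simp [CoinducedBimodule.evalOne_unit]
  · obtain ⟨F, rfl⟩ := proj_surjective z
    change proj k C X (F - CoinducedBimodule.unit k C X (CoinducedBimodule.evalOne F)) =
      proj k C X F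
    rw [map_sub, exact_unit_proj.apply_apply_eq_zero, sub_zero]

end Cosyzygy

end Cosyzygy

/-! ### Acyclicity of coinduced bimodules -/

section CoinducedAcyclic

variable {k : Type u} [CommRing k] {C : Type v} [Ring C] [Algebra k C]
  {V : Type v} [AddCommGroup V] [Module k V]

namespace CoinducedBimodule

/-- The retraction `Hom_k(C, I) → I` that makes a coinduced bimodule `I` left coinduced. -/
def leftRetraction :
    (C →ₗ[k] CoinducedBimodule k C V) →ₗ[k] CoinducedBimodule k C V where
  toFun g := mk (fun x y => (g x).eval 1 y) (by simp) (by simp) (by simp) (by simp)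
  map_add' _ _ := by ext; simp
  map_smul' _ _ := by ext; simp

/-- The left variable of `F` is itself a coinduction variable: the value of x F at (1, y) is F(x,
y). -/
theorem isLeftCoinduced_leftRetraction :
    IsLeftCoinduced k C (CoinducedBimodule k C V) leftRetraction where
  retract g F h := by ext; simp [leftRetraction, h]
  smul g g' c h := by ext; simp [leftRetraction, h]
  op_smul g g' c h := by ext; simp [leftRetraction, h]

end CoinducedBimodule

end CoinducedAcyclic

/-! ### Corners of coinduced bimodules over the triangular algebra -/

namespace TriangularAlgebra

variable {k : Type u} {A M B : Type v} [CommRing k] [Ring A] [Algebra k A] [Ring B] [Algebra k B]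
  [AddCommGroup M] [Module k M] [Module A M] [Module Bᵐᵒᵖ M]
  [IsScalarTower k A M] [IsScalarTower k Bᵐᵒᵖ M] [SMulCommClass A Bᵐᵒᵖ M]

local notation "E" => TriangularAlgebra A M B
local notation "eA" => inA k A M B 1
local notation "eB" => inB k A M B 1

section Coinduced

variable {V : Type v} [AddCommGroup V] [Module k V]

local notation "I" => CoinducedBimodule k (TriangularAlgebra A M B) V

theorem mem_corner_coinduced {A' B' : Type v} [Ring A'] [Algebra k A'] [Ring B'] [Algebra k B']
    (φ : A' →ₙₐ[k] E) (ψ : B' →ₙₐ[k] E) (F : I)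
    (h : ∀ x y, F.eval (x * φ 1) (ψ 1 * y) = F.eval x y) : F ∈ corner φ ψ I :=
  ⟨F, CoinducedBimodule.ext h⟩

theorem eval_mul_left_of_mem_corner {A' B' : Type v} [Ring A'] [Algebra k A'] [Ring B']
    [Algebra k B'] {φ : A' →ₙₐ[k] E} {ψ : B' →ₙₐ[k] E} (F : corner φ ψ I) (x y : E) :
    F.1.eval (x * φ 1) y = F.1.eval x y := by
  rw [← CoinducedBimodule.eval_left_smul, one_smul_corner φ ψ F.2]

theorem eval_mul_right_of_mem_corner {A' B' : Type v} [Ring A'] [Algebra k A'] [Ring B']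
    [Algebra k B'] {φ : A' →ₙₐ[k] E} {ψ : B' →ₙₐ[k] E} (F : corner φ ψ I) (x y : E) :
    F.1.eval x (ψ 1 * y) = F.1.eval x y := by
  rw [← MulOpposite.unop_op (ψ 1), ← CoinducedBimodule.eval_right_smul,
    op_one_smul_corner φ ψ F.2]

/-- Here triangularity enters: E 1_A = A and 1_B E = B. In a corner cut by 1_A on the left, the
first variable of a bilinear map matters only through its A entry; in one cut by 1_B on the right,
the second only through its B entry. -/
theorem mul_inA_one (x : E) : x * eA = inA k A M B x.a := by ext <;> simp

theorem inB_one_mul (x : E) : eB * x = inB k A M B x.b := by ext <;> simp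

/-- The retraction that makes the `A`-bimodule `1_A I 1_A` coinduced. -/
def retractionAA : (A →ₗ[k] XAA k A M B I) →ₗ[k] XAA k A M B I where
  toFun g := ⟨.mk (fun x y => (g x.a).1.eval 1 y) (by simp) (by simp) (by simp) (by simp),
    mem_corner_coinduced _ _ _ fun x y => by
      simp only [CoinducedBimodule.eval_mk, eval_mul_right_of_mem_corner, mul_a, inA_apply_a,
        mul_one]⟩
  map_add' g g' := Subtype.ext (by ext; simp)
  map_smul' r g := Subtype.ext (by ext; simp)

theorem eval_retractionAA (g : A →ₗ[k] XAA k A M B I) (x y : E) :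
    (retractionAA g).1.eval x y = (g x.a).1.eval 1 y := rfl

/-- Elements of this corner are bilinear maps on E 1_A × 1_A E, whose first factor is A. The second
factor also contains M, so the left variable is the one to contract. -/
theorem isLeftCoinduced_retractionAA :
    IsLeftCoinduced k A (XAA k A M B I) retractionAA where
  retract g F h := by
    refine Subtype.ext (CoinducedBimodule.ext fun x y => ?_)
    rw [eval_retractionAA, h, coe_smul_corner, CoinducedBimodule.eval_left_smul, one_mul,
      ← mul_inA_one, eval_mul_left_of_mem_corner]
  smul g g' c h := by
    refine Subtype.ext (CoinducedBimodule.ext fun x y => ?_)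
    rw [eval_retractionAA, h, coe_smul_corner, CoinducedBimodule.eval_left_smul,
      eval_retractionAA, mul_a, inA_apply_a]
  op_smul g g' c h := by
    refine Subtype.ext (CoinducedBimodule.ext fun x y => ?_)
    rw [eval_retractionAA, h, coe_op_smul_corner, coe_op_smul_corner,
      CoinducedBimodule.eval_right_smul, CoinducedBimodule.eval_right_smul, eval_retractionAA]

/-- The retraction that makes the `B`-bimodule `1_B I 1_B` coinduced. -/
def retractionBB : (B →ₗ[k] XBB k A M B I) →ₗ[k] XBB k A M B I where
  toFun g := ⟨.mk (fun x y => (g y.b).1.eval x 1) (by simp) (by simp) (by simp) (by simp),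
    mem_corner_coinduced _ _ _ fun x y => by
      simp only [CoinducedBimodule.eval_mk, eval_mul_left_of_mem_corner, mul_b, inB_apply_b,
        one_mul]⟩
  map_add' g g' := Subtype.ext (by ext; simp)
  map_smul' r g := Subtype.ext (by ext; simp)

theorem eval_retractionBB (g : B →ₗ[k] XBB k A M B I) (x y : E) :
    (retractionBB g).1.eval x y = (g y.b).1.eval x 1 := rfl

/-- Elements of this corner are bilinear maps on E 1_B × 1_B E. The first factor contains M besides
B, the second is exactly B, so the contraction is on the right. -/
theorem isRightCoinduced_retractionBB :
    IsRightCoinduced k B (XBB k A M B I) retractionBB where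
  retract g F h := by
    refine Subtype.ext (CoinducedBimodule.ext fun x y => ?_)
    rw [eval_retractionBB, h, coe_op_smul_corner, CoinducedBimodule.eval_right_smul, mul_one,
      MulOpposite.unop_op, ← inB_one_mul, eval_mul_right_of_mem_corner]
  op_smul g g' c h := by
    refine Subtype.ext (CoinducedBimodule.ext fun x y => ?_)
    rw [eval_retractionBB, h, coe_op_smul_corner, CoinducedBimodule.eval_right_smul,
      eval_retractionBB, MulOpposite.unop_op, mul_b, inB_apply_b]
  smul g g' c h := by
    refine Subtype.ext (CoinducedBimodule.ext fun x y => ?_)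
    rw [eval_retractionBB, h, coe_smul_corner, coe_smul_corner,
      CoinducedBimodule.eval_left_smul, CoinducedBimodule.eval_left_smul, eval_retractionBB]

attribute [local instance] TensorProduct.Algebra.module isScalarTower_tensorProduct_op

/-- The retraction that makes the `A ⊗ Bᵒᵖ`-module `1_A I 1_B` coinduced. -/
def retractionAB (g : A ⊗[k] Bᵐᵒᵖ →ₗ[k] XAB k A M B I) : XAB k A M B I :=
  ⟨.mk (fun x y => (g (x.a ⊗ₜ MulOpposite.op y.b)).1.eval 1 1)
    (by simp [TensorProduct.add_tmul]) (fun r x y => by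
      rw [smul_a, ← TensorProduct.smul_tmul', map_smul]; rfl)
    (by simp [TensorProduct.tmul_add]) (by simp),
    mem_corner_coinduced _ _ _ fun x y => by
      simp only [CoinducedBimodule.eval_mk, mul_a, mul_b, inA_apply_a, inB_apply_b,
        mul_one, one_mul]⟩

theorem eval_retractionAB (g : A ⊗[k] Bᵐᵒᵖ →ₗ[k] XAB k A M B I) (x y : E) :
    (retractionAB g).1.eval x y = (g (x.a ⊗ₜ MulOpposite.op y.b)).1.eval 1 1 := rfl

theorem coe_tmul_smul {X : Type v} [AddCommGroup X] [Module k X]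
    [Module (TriangularAlgebra A M B) X] [Module (TriangularAlgebra A M B)ᵐᵒᵖ X]
    [IsScalarTower k (TriangularAlgebra A M B) X] [IsScalarTower k (TriangularAlgebra A M B)ᵐᵒᵖ X]
    [SMulCommClass (TriangularAlgebra A M B) (TriangularAlgebra A M B)ᵐᵒᵖ X]
    (a : A) (b : B) (y : XAB k A M B X) :
    ((a ⊗ₜ[k] MulOpposite.op b : A ⊗[k] Bᵐᵒᵖ) • y : XAB k A M B X).1 =
      inA k A M B a • MulOpposite.op (inB k A M B b) • y.1 := by
  rw [TensorProduct.Algebra.smul_def]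
  rfl

theorem retractionAB_add (g g' : A ⊗[k] Bᵐᵒᵖ →ₗ[k] XAB k A M B I) :
    retractionAB (g + g') = retractionAB g + retractionAB g' :=
  Subtype.ext (CoinducedBimodule.ext fun _ _ => rfl)

/-- Elements of this corner are bilinear maps on E 1_A × 1_B E = A × B, recovered by acting with a ⊗
b and evaluating at (1, 1). -/
theorem retractionAB_retract (g : A ⊗[k] Bᵐᵒᵖ →ₗ[k] XAB k A M B I) (F : XAB k A M B I)
    (h : ∀ r, g r = r • F) : retractionAB g = F := by
  refine Subtype.ext (CoinducedBimodule.ext fun x y => ?_)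
  rw [eval_retractionAB, h, coe_tmul_smul, CoinducedBimodule.eval_left_smul,
    CoinducedBimodule.eval_right_smul, one_mul, mul_one, MulOpposite.unop_op, ← mul_inA_one,
    ← inB_one_mul, eval_mul_left_of_mem_corner, eval_mul_right_of_mem_corner]

theorem retractionAB_smul (g g' : A ⊗[k] Bᵐᵒᵖ →ₗ[k] XAB k A M B I) (r : A ⊗[k] Bᵐᵒᵖ)
    (h : ∀ x, g' x = g (x * r)) : retractionAB g' = r • retractionAB g := by
  -- With `g'` expressed through `r`, the claim is additive in `r` and reduces to pure tensors.
  obtain rfl : g' = g ∘ₗ LinearMap.mulRight k r := LinearMap.ext h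
  clear h
  induction r with
  | zero =>
    refine Eq.trans ?_ (zero_smul (A ⊗[k] Bᵐᵒᵖ) (retractionAB g)).symm
    refine Subtype.ext (CoinducedBimodule.ext fun x y => ?_)
    rw [eval_retractionAB, LinearMap.comp_apply, LinearMap.mulRight_apply]
    have : (x.a ⊗ₜ[k] MulOpposite.op y.b : A ⊗[k] Bᵐᵒᵖ) * 0 = 0 := mul_zero _
    rw [this, map_zero]
    rfl
  | tmul a b =>
    refine Subtype.ext (CoinducedBimodule.ext fun x y => ?_)
    obtain ⟨b, rfl⟩ := MulOpposite.op_surjective b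
    rw [eval_retractionAB, LinearMap.comp_apply, LinearMap.mulRight_apply, coe_tmul_smul,
      CoinducedBimodule.eval_left_smul, CoinducedBimodule.eval_right_smul, eval_retractionAB,
      Algebra.TensorProduct.tmul_mul_tmul, MulOpposite.unop_op, mul_a, mul_b, inA_apply_a,
      inB_apply_b, MulOpposite.op_mul]
  | add r s hr hs =>
    rw [add_smul, ← hr, ← hs, ← retractionAB_add]
    congr 1
    refine LinearMap.ext fun x => ?_
    simp only [LinearMap.comp_apply, LinearMap.mulRight_apply, LinearMap.add_apply, mul_add,
      map_add]

variable (V) in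
-- In the long exact sequence the neighbours are diagonal cohomology one degree lower and Hochschild
-- cohomology of E, both zero in positive degrees. Degree 1 escapes, since its left neighbour has
-- degree 0.
theorem isZero_homology_offDiagComplex_coinduced (n : ℕ) :
    Limits.IsZero ((offDiagComplex k A M B I).homology (n + 2)) := by
  have hS := diagShortComplex_shortExact k A M B I
  refine (hS.homology_exact₁ (n + 1) (n + 2) rfl).isZero_of_both_zeros ?_ ?_
  · refine Limits.IsZero.eq_of_src ?_ _ _
    refine isZero_homology_sequenceComplex_succ
      (hd := fun n => prodMap_comp_eq_zero n (hochschildD_comp k A (XAA k A M B I))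
        (hochschildD_comp k B (XBB k A M B I))) n ?_
    rintro ⟨f, g⟩ hfg
    obtain ⟨f', hf'⟩ := isLeftCoinduced_retractionAA.exists_hochschildD_eq f
      (congrArg Prod.fst hfg)
    obtain ⟨g', hg'⟩ := isRightCoinduced_retractionBB.exists_hochschildD_eq g
      (congrArg Prod.snd hfg)
    exact ⟨(f', g'), Prod.ext hf' hg'⟩
  · refine Limits.IsZero.eq_of_tgt ?_ _ _
    exact isZero_homology_sequenceComplex_succ (hd := hochschildD_comp k E I) (n + 1) fun f hf =>
      CoinducedBimodule.isLeftCoinduced_leftRetraction.exists_hochschildD_eq f hf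

variable (V) in
theorem isZero_homology_homD_coinduced (P : BimoduleResolution k A B M) (n : ℕ) :
    Limits.IsZero ((sequenceComplex (P.homD (XAB k A M B I))
      (P.homD_comp (XAB k A M B I))).homology (n + 1)) :=
  P.isZero_homology_homD_succ _ retractionAB retractionAB_retract retractionAB_add
    retractionAB_smul n

end Coinduced

end TriangularAlgebra

/-! ### Low degrees -/

section LowDegrees

variable {k : Type u} [CommRing k]
  {C : Type v} [Ring C] [Algebra k C]
  {Y : Type v} [AddCommGroup Y] [Module k Y] [Module C Y] [Module Cᵐᵒᵖ Y]
  [IsScalarTower k C Y] [IsScalarTower k Cᵐᵒᵖ Y] [SMulCommClass C Cᵐᵒᵖ Y]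

theorem hochschildD_zero_apply (f : HochschildCochain k C Y 0) (c : Fin 1 → C) :
    hochschildD k C Y 0 f c = c 0 • f Fin.elim0 - MulOpposite.op (c 0) • f Fin.elim0 := by
  have h : ∀ w : Fin 0 → C, f w = f Fin.elim0 := fun w => congrArg f (Subsingleton.elim _ _)
  rw [hochschildD_apply, Fin.sum_univ_two]
  simp [hochschildCofaceFun, sub_eq_add_neg, h]

theorem hochschildD_one_apply (f : HochschildCochain k C Y 1) (c : Fin 2 → C) :
    hochschildD k C Y 1 f c =
      c 0 • f (fun _ => c 1) - f (fun _ => c 0 * c 1) + MulOpposite.op (c 1) • f fun _ => c 0 := by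
  have h : ∀ w : Fin 1 → C, f w = f fun _ => w 0 := fun w =>
    congrArg f (funext fun i => congrArg w (Subsingleton.elim _ _))
  have h₀ : hochschildCofaceFun 0 f c = c 0 • f fun _ => c 1 := by
    rw [hochschildCofaceFun, if_pos rfl, h]
    rfl
  have h₁ : hochschildCofaceFun 1 f c = f fun _ => c 0 * c 1 := by
    rw [hochschildCofaceFun, if_neg (by omega), if_neg (by omega), h]
    rfl
  have h₂ : hochschildCofaceFun 2 f c = MulOpposite.op (c 1) • f fun _ => c 0 := by
    rw [hochschildCofaceFun, if_neg (by omega), if_pos rfl, h]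
    rfl
  rw [hochschildD_apply, Fin.sum_univ_three]
  simp [h₀, h₁, h₂, sub_eq_add_neg]

end LowDegrees

/-! ### Degrees zero and one of the off-diagonal complex -/

namespace TriangularAlgebra

variable {k : Type u} {A M B : Type v} [CommRing k] [Ring A] [Algebra k A] [Ring B] [Algebra k B]
  [AddCommGroup M] [Module k M] [Module A M] [Module Bᵐᵒᵖ M]
  [IsScalarTower k A M] [IsScalarTower k Bᵐᵒᵖ M] [SMulCommClass A Bᵐᵒᵖ M]
  {X : Type v} [AddCommGroup X] [Module k X]
  [Module (TriangularAlgebra A M B) X] [Module (TriangularAlgebra A M B)ᵐᵒᵖ X]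
  [IsScalarTower k (TriangularAlgebra A M B) X] [IsScalarTower k (TriangularAlgebra A M B)ᵐᵒᵖ X]
  [SMulCommClass (TriangularAlgebra A M B) (TriangularAlgebra A M B)ᵐᵒᵖ X]

local notation "E" => TriangularAlgebra A M B
local notation "eA" => inA k A M B 1
local notation "eB" => inB k A M B 1

attribute [local instance] TensorProduct.Algebra.module isScalarTower_tensorProduct_op

theorem eA_mul_inM (m : M) : eA * inM k A M B m = inM k A M B m := by ext <;> simp
theorem inM_mul_eB (m : M) : inM k A M B m * eB = inM k A M B m := by ext <;> simp
theorem inM_smul (a : A) (m : M) : inM k A M B (a • m) = inA k A M B a * inM k A M B m := by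
  ext <;> simp
theorem inM_op_smul (b : Bᵐᵒᵖ) (m : M) :
    inM k A M B (b • m) = inM k A M B m * inB k A M B b.unop := by
  ext <;> simp

/-- Left multiplication by `m` carries the BB corner of `w` to the AB corner of m w, and right
multiplication does the same from the AA corner. So elements with zero diagonal corners contribute
nothing to the AB corner after multiplication by M. -/
theorem corner_inM_smul (m : M) (w : X) :
    eA • MulOpposite.op eB • inM k A M B m • w =
      inM k A M B m • eB • MulOpposite.op eB • w := by
  rw [← smul_comm (inM k A M B m) (MulOpposite.op eB), ← mul_smul, ← mul_smul, eA_mul_inM,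
    inM_mul_eB]

theorem corner_op_inM_smul (m : M) (w : X) :
    eA • MulOpposite.op eB • MulOpposite.op (inM k A M B m) • w =
      MulOpposite.op (inM k A M B m) • eA • MulOpposite.op eA • w := by
  rw [smul_comm eA (MulOpposite.op eA), ← mul_smul (MulOpposite.op (inM k A M B m)),
    ← mul_smul (MulOpposite.op eB), ← MulOpposite.op_mul, ← MulOpposite.op_mul, eA_mul_inM,
    inM_mul_eB, smul_comm eA]

theorem smul_XAB (x : E) (z : XAB k A M B X) : x • (z : X) = ((x.a • z : XAB k A M B X) : X) := by
  rw [coe_smul_corner, ← mul_inA_one, mul_smul, one_smul_corner _ _ z.2]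

theorem op_smul_XAB (x : E) (z : XAB k A M B X) :
    MulOpposite.op x • (z : X) = ((MulOpposite.op x.b • z : XAB k A M B X) : X) := by
  rw [coe_op_smul_corner, ← inB_one_mul, MulOpposite.op_mul, mul_smul, op_one_smul_corner _ _ z.2]

theorem OffDiagCochain.corner_AA_zero (f : OffDiagCochain k A M B X 0) :
    eA • MulOpposite.op eA • f.1 Fin.elim0 = 0 := by
  have h := congrArg Subtype.val (DFunLike.congr_fun (congrArg Prod.fst f.2) Fin.elim0)
  rw [diagRestrict_apply_fst] at h
  rwa [Subsingleton.elim (Fin.elim0 : Fin 0 → E)]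

theorem OffDiagCochain.corner_BB_zero (f : OffDiagCochain k A M B X 0) :
    eB • MulOpposite.op eB • f.1 Fin.elim0 = 0 := by
  have h := congrArg Subtype.val (DFunLike.congr_fun (congrArg Prod.snd f.2) Fin.elim0)
  rw [diagRestrict_apply_snd] at h
  rwa [Subsingleton.elim (Fin.elim0 : Fin 0 → E)]

theorem OffDiagCochain.corner_AA_one (f : OffDiagCochain k A M B X 1) (a : A) :
    eA • MulOpposite.op eA • f.1 (fun _ => inA k A M B a) = 0 :=
  congrArg Subtype.val (DFunLike.congr_fun (congrArg Prod.fst f.2) fun _ => a)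

theorem OffDiagCochain.corner_BB_one (f : OffDiagCochain k A M B X 1) (b : B) :
    eB • MulOpposite.op eB • f.1 (fun _ => inB k A M B b) = 0 :=
  congrArg Subtype.val (DFunLike.congr_fun (congrArg Prod.snd f.2) fun _ => b)

variable (k A M B X) in
-- A 0-cocycle is an element z commuting with E, so 1_A z = 1_A z 1_A = 0 and 1_B z = 1_B z 1_B = 0,
-- and the two idempotents add up to 1.
theorem isZero_homology_offDiagComplex_zero :
    Limits.IsZero ((offDiagComplex k A M B X).homology 0) := by
  refine isZero_homology_sequenceComplex_zero fun f hf => ?_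
  have hc : ∀ c : E, c • f.1 Fin.elim0 = MulOpposite.op c • f.1 Fin.elim0 := fun c => by
    have := DFunLike.congr_fun (congrArg Subtype.val hf) fun _ => c
    exact sub_eq_zero.1 ((hochschildD_zero_apply f.1 fun _ => c).symm.trans this)
  have h₁ : eA • f.1 Fin.elim0 = 0 := by
    have h := f.corner_AA_zero
    rwa [← hc, ← mul_smul, ← map_mul, one_mul] at h
  have h₂ : eB • f.1 Fin.elim0 = 0 := by
    have h := f.corner_BB_zero
    rwa [← hc, ← mul_smul, ← map_mul, one_mul] at h
  refine Subtype.ext (MultilinearMap.ext fun c => ?_)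
  rw [Subsingleton.elim c Fin.elim0, ← one_smul E (f.1 Fin.elim0),
    ← inA_one_add_inB_one (k := k), add_smul, h₁, h₂, add_zero]
  rfl

variable (k A M B X) in
/-- The off-diagonal `1`-cochain defined by a map of bimodules `M → 1_A X 1_B`. -/
def homToOffDiag : (M →ₗ[A ⊗[k] Bᵐᵒᵖ] XAB k A M B X) →ₗ[k] OffDiagCochain k A M B X 1 where
  toFun g := ⟨MultilinearMap.ofSubsingleton k E X 0
      ((XAB k A M B X).subtype ∘ₗ g.restrictScalars k ∘ₗ projM k A M B), by
    refine Prod.ext (MultilinearMap.ext fun c => Subtype.ext ?_)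
      (MultilinearMap.ext fun c => Subtype.ext ?_)
    · rw [diagRestrict_apply_fst]
      simp
    · rw [diagRestrict_apply_snd]
      simp⟩
  map_add' g g' := rfl
  map_smul' r g := rfl

theorem homToOffDiag_apply (g : M →ₗ[A ⊗[k] Bᵐᵒᵖ] XAB k A M B X) (c : Fin 1 → E) :
    (homToOffDiag k A M B X g).1 c = g (c 0).m :=
  rfl

/-- On X_AB the algebra E acts through its diagonal entries, so the derivation rule for x ↦ g(x.m)
is bimodule linearity of g. -/
theorem offDiagD_comp_homToOffDiag : offDiagD k A M B X 1 ∘ₗ homToOffDiag k A M B X = 0 := by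
  refine LinearMap.ext fun g => Subtype.ext (MultilinearMap.ext fun c => ?_)
  refine (hochschildD_one_apply _ c).trans ?_
  change c 0 • (g (c 1).m : X) - (g (c 0 * c 1).m : X) + MulOpposite.op (c 1) • (g (c 0).m : X) = 0
  rw [smul_XAB, op_smul_XAB, mul_m, map_add, tensorLinearMap_smul, tensorLinearMap_op_smul,
    Submodule.coe_add]
  abel

/-- The map `Hom(M, 1_A X 1_B) → H¹` of the off-diagonal complex. -/
noncomputable def homToOffDiagHomology : ModuleCat.of k (M →ₗ[A ⊗[k] Bᵐᵒᵖ] XAB k A M B X) ⟶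
    (offDiagComplex k A M B X).homology 1 :=
  sequenceClass _ 1 (homToOffDiag k A M B X) offDiagD_comp_homToOffDiag

/-- A derivation killing 1_A also kills 1_B, since D(1) = 0, and therefore preserves the corners.
Its values on A and B equal their own diagonal corners, which are zero by hypothesis; only M → X_AB
survives. -/
theorem derivation_eq (D : E → X) (hadd : ∀ x y, D (x + y) = D x + D y)
    (hmul : ∀ x y, D (x * y) = x • D y + MulOpposite.op y • D x)
    (hA : ∀ a, eA • MulOpposite.op eA • D (inA k A M B a) = 0)
    (hB : ∀ b, eB • MulOpposite.op eB • D (inB k A M B b) = 0) (hD : D eA = 0) (c : E) :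
    D c = eA • MulOpposite.op eB • D (inM k A M B c.m) := by
  have h1 : D 1 = 0 := by
    have := hmul 1 1
    simpa using this
  have hD' : D eB = 0 := by
    rw [← inA_one_add_inB_one (k := k), hadd, hD, zero_add] at h1
    exact h1
  have h₁ : D (inA k A M B c.a) = 0 := by
    have h := hmul eA (inA k A M B c.a * eA)
    rw [hmul (inA k A M B c.a), hD, show eA * (inA k A M B c.a * eA) = inA k A M B c.a by
      simp [← map_mul]] at h
    rw [h, smul_zero, smul_zero, zero_add, add_zero, hA]
  have h₂ : D (inB k A M B c.b) = 0 := by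
    have h := hmul eB (inB k A M B c.b * eB)
    rw [hmul (inB k A M B c.b), hD', show eB * (inB k A M B c.b * eB) = inB k A M B c.b by
      simp [← map_mul]] at h
    rw [h, smul_zero, smul_zero, zero_add, add_zero, hB]
  have h₃ : D (inM k A M B c.m) = eA • MulOpposite.op eB • D (inM k A M B c.m) := by
    conv_lhs => rw [← eA_mul_inM, hmul, hD, ← inM_mul_eB, hmul, hD']
    simp
  conv_lhs => rw [eq_inA_add_inM_add_inB (k := k) c, hadd, hadd, h₁, h₂, zero_add, add_zero]
  exact h₃

/-- Injective, because an off-diagonal 0-cochain has a coboundary whose values on M have zero AB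
corner. Surjective, because an off-diagonal 1-cocycle is a derivation that can be normalized to kill
1_A by an inner derivation coming from an off-diagonal element. -/
theorem homToOffDiagHomology_bijective :
    Function.Bijective (homToOffDiagHomology (k := k) (A := A) (M := M) (B := B) (X := X)) := by
  refine sequenceClass_bijective_succ (hd := offDiagD_comp k A M B X) 0 _ _ ?_ ?_
  · intro g y hy
    refine LinearMap.ext fun m => Subtype.ext ?_
    have h := DFunLike.congr_fun (congrArg Subtype.val hy) fun _ => inM k A M B m
    replace h := (hochschildD_zero_apply y.1 _).symm.trans h
    rw [homToOffDiag_apply, inM_apply_m] at h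
    rw [← one_smul_corner _ _ (g m).2, ← op_one_smul_corner _ _ (g m).2, ← h, smul_sub, smul_sub,
      corner_inM_smul, corner_op_inM_smul, y.corner_AA_zero, y.corner_BB_zero]
    simp
  · intro f hf
    have hmul : ∀ x y : E, f.1 (fun _ => x * y) =
        x • f.1 (fun _ => y) + MulOpposite.op y • f.1 fun _ => x := fun x y => by
      have h := DFunLike.congr_fun (congrArg Subtype.val hf) ![x, y]
      replace h := (hochschildD_one_apply f.1 _).symm.trans h
      simp only [Matrix.cons_val_zero, Matrix.cons_val_one] at h
      rw [sub_add_eq_add_sub] at h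
      exact (sub_eq_zero.1 h).symm
    let D : E →ₗ[k] X := (MultilinearMap.ofSubsingleton k E X (0 : Fin 1)).symm f.1
    have hD : ∀ x, f.1 (fun _ => x) = D x := fun x => rfl
    simp only [hD] at hmul
    have hAA : ∀ a, eA • MulOpposite.op eA • D (inA k A M B a) = 0 := f.corner_AA_one
    have hBB : ∀ b, eB • MulOpposite.op eB • D (inB k A M B b) = 0 := f.corner_BB_one
    -- In D(a m) = a D(m) + D(a) m the AB corner of the last term is the AA corner of D(a) times m,
    -- which is zero; similarly on the right with B.
    let g : M →ₗ[A ⊗[k] Bᵐᵒᵖ] XAB k A M B X :=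
      tensorLinearMap (cornerProj _ _ ∘ₗ D ∘ₗ inM k A M B)
        (fun a m => by
          simp only [LinearMap.comp_apply]
          rw [inM_smul, hmul, map_add, cornerProj_smul, add_eq_left]
          refine Subtype.ext ?_
          rw [coe_cornerProj, corner_op_inM_smul, hAA, smul_zero]
          rfl)
        (fun b m => by
          obtain ⟨b, rfl⟩ := MulOpposite.op_surjective b
          simp only [LinearMap.comp_apply]
          rw [inM_op_smul, MulOpposite.unop_op, hmul, map_add, cornerProj_op_smul, add_eq_right]
          refine Subtype.ext ?_
          rw [coe_cornerProj, corner_inM_smul, hBB, smul_zero]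
          rfl)
    have hg : ∀ m, (g m : X) = eA • MulOpposite.op eB • D (inM k A M B m) := fun m => rfl
    let u := D eA
    -- Since u = 1_A u + u 1_A and 1_A u 1_A = 0, the inner derivation c ↦ c w - w c takes the value
    -- u at 1_A. Both diagonal corners of w vanish, so w is an admissible 0-cochain.
    let w : X := eA • u - MulOpposite.op eA • u
    have hAAA : eA * eA = eA := by rw [← map_mul, one_mul]
    have hwA : eA • MulOpposite.op eA • w = 0 := by
      simp only [w, smul_sub, ← mul_smul, ← MulOpposite.op_mul, hAAA]
      rw [← smul_comm eA (MulOpposite.op eA), ← mul_smul, hAAA, sub_self]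
    have hwB : eB • MulOpposite.op eB • w = 0 := by
      simp only [w, smul_sub, ← mul_smul, ← MulOpposite.op_mul, inA_one_mul_inB_one]
      rw [← smul_comm eA (MulOpposite.op eB), ← mul_smul, inB_one_mul_inA_one]
      simp
    let D' : E → X := fun c => D c - (c • w - MulOpposite.op c • w)
    have hD'A : D' eA = 0 := by
      have hu : u = eA • u + MulOpposite.op eA • u := by
        have := hmul eA eA
        rwa [hAAA] at this
      have hu' : eA • MulOpposite.op eA • u = 0 := hAA 1
      simp only [D', w, smul_sub, ← mul_smul, ← MulOpposite.op_mul, hAAA]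
      rw [← smul_comm eA (MulOpposite.op eA) u, hu', sub_zero, zero_sub, sub_neg_eq_add]
      exact sub_eq_zero.2 hu
    have key := derivation_eq (k := k) D'
      (fun x y => by
        simp only [D', map_add, add_smul, MulOpposite.op_add]
        abel)
      (fun x y => by
        simp only [D', hmul, mul_smul, MulOpposite.op_mul, smul_sub]
        rw [smul_comm x (MulOpposite.op y) w]
        abel)
      (fun a => by
        have e₁ : eA • MulOpposite.op eA • inA k A M B a • w =
            inA k A M B a • eA • MulOpposite.op eA • w := by
          rw [← smul_comm (inA k A M B a) (MulOpposite.op eA), ← mul_smul, ← mul_smul, ← map_mul,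
            ← map_mul, one_mul, mul_one]
        have e₂ : eA • MulOpposite.op eA • MulOpposite.op (inA k A M B a) • w =
            MulOpposite.op (inA k A M B a) • eA • MulOpposite.op eA • w := by
          rw [← smul_comm eA (MulOpposite.op (inA k A M B a)), ← mul_smul (MulOpposite.op eA),
            ← mul_smul (MulOpposite.op (inA k A M B a)), ← MulOpposite.op_mul, ← MulOpposite.op_mul,
            ← map_mul, ← map_mul, one_mul, mul_one]
        simp only [D', smul_sub, hAA, e₁, e₂, hwA, smul_zero, sub_zero])
      (fun b => by
        have e₁ : eB • MulOpposite.op eB • inB k A M B b • w =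
            inB k A M B b • eB • MulOpposite.op eB • w := by
          rw [← smul_comm (inB k A M B b) (MulOpposite.op eB), ← mul_smul, ← mul_smul, ← map_mul,
            ← map_mul, one_mul, mul_one]
        have e₂ : eB • MulOpposite.op eB • MulOpposite.op (inB k A M B b) • w =
            MulOpposite.op (inB k A M B b) • eB • MulOpposite.op eB • w := by
          rw [← smul_comm eB (MulOpposite.op (inB k A M B b)), ← mul_smul (MulOpposite.op eB),
            ← mul_smul (MulOpposite.op (inB k A M B b)), ← MulOpposite.op_mul, ← MulOpposite.op_mul,
            ← map_mul, ← map_mul, one_mul, mul_one]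
        simp only [D', smul_sub, hBB, e₁, e₂, hwB, smul_zero, sub_zero])
      hD'A
    refine ⟨g, ⟨MultilinearMap.constOfIsEmpty k (fun _ : Fin 0 => E) w, ?_⟩,
      Subtype.ext (MultilinearMap.ext fun c => ?_)⟩
    · exact Prod.ext (MultilinearMap.ext fun c => Subtype.ext hwA)
        (MultilinearMap.ext fun c => Subtype.ext hwB)
    · refine (hochschildD_zero_apply _ c).trans ?_
      change c 0 • w - MulOpposite.op (c 0) • w = f.1 c - (g (c 0).m : X)
      have hc : f.1 c = D (c 0) :=
        congrArg f.1 (funext fun i => congrArg c (Subsingleton.elim (α := Fin 1) i 0))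
      have h := key (c 0)
      -- Subtracting the inner derivation leaves the AB corner on M unchanged, so the normalized
      -- derivation is the cochain of `g`.
      simp only [D', smul_sub, corner_inM_smul, corner_op_inM_smul, hwA, hwB, smul_zero,
        sub_zero] at h
      rw [hc, hg, ← h, sub_sub_cancel]

end TriangularAlgebra

/-! ### The cohomology of the off-diagonal complex -/

namespace TriangularAlgebra

variable {k : Type u} {A M B : Type v} [CommRing k] [Ring A] [Algebra k A] [Ring B] [Algebra k B]
  [AddCommGroup M] [Module k M] [Module A M] [Module Bᵐᵒᵖ M]
  [IsScalarTower k A M] [IsScalarTower k Bᵐᵒᵖ M] [SMulCommClass A Bᵐᵒᵖ M]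

local notation "E" => TriangularAlgebra A M B

attribute [local instance] TensorProduct.Algebra.module isScalarTower_tensorProduct_op

section

variable {X : Type v} [AddCommGroup X] [Module k X]
  [Module (TriangularAlgebra A M B) X] [Module (TriangularAlgebra A M B)ᵐᵒᵖ X]
  [IsScalarTower k (TriangularAlgebra A M B) X] [IsScalarTower k (TriangularAlgebra A M B)ᵐᵒᵖ X]
  [SMulCommClass (TriangularAlgebra A M B) (TriangularAlgebra A M B)ᵐᵒᵖ X]
  {Y : Type v} [AddCommGroup Y] [Module k Y]
  [Module (TriangularAlgebra A M B) Y] [Module (TriangularAlgebra A M B)ᵐᵒᵖ Y]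
  [IsScalarTower k (TriangularAlgebra A M B) Y] [IsScalarTower k (TriangularAlgebra A M B)ᵐᵒᵖ Y]
  [SMulCommClass (TriangularAlgebra A M B) (TriangularAlgebra A M B)ᵐᵒᵖ Y]
  {Z : Type v} [AddCommGroup Z] [Module k Z]
  [Module (TriangularAlgebra A M B) Z] [Module (TriangularAlgebra A M B)ᵐᵒᵖ Z]
  [IsScalarTower k (TriangularAlgebra A M B) Z] [IsScalarTower k (TriangularAlgebra A M B)ᵐᵒᵖ Z]
  [SMulCommClass (TriangularAlgebra A M B) (TriangularAlgebra A M B)ᵐᵒᵖ Z]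

/-- The `A ⊗ Bᵒᵖ`-linear map on corners induced by a map of bimodules. -/
def cornerLinearMap (f : X →ₗ[k] Y) (hf : IsBimoduleMap E f) :
    XAB k A M B X →ₗ[A ⊗[k] Bᵐᵒᵖ] XAB k A M B Y :=
  tensorLinearMap (cornerMap _ _ f hf) (cornerMap_smul _ _ f hf) (cornerMap_op_smul _ _ f hf)

theorem homToOffDiagHomology_comp_homologyMap (f : X →ₗ[k] Y) (hf : IsBimoduleMap E f)
    (g : Y →ₗ[k] Z) (hg : IsBimoduleMap E g) (hinj : Function.Injective f)
    (h : Function.Exact f g) :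
    homToOffDiagHomology (X := Y) ≫
        HomologicalComplex.homologyMap (offDiagShortComplex f hf g hg hinj h).g 1 =
      ModuleCat.ofHom (RelProjResolution.homPostcomp k M (cornerLinearMap g hg)) ≫
        homToOffDiagHomology (X := Z) :=
  sequenceClass_comp_homologyMap (hd := offDiagD_comp k A M B Y) (hd' := offDiagD_comp k A M B Z) 1
    (homToOffDiag k A M B Y) offDiagD_comp_homToOffDiag (homToOffDiag k A M B Z)
    offDiagD_comp_homToOffDiag (offDiagMap g hg) (offDiagD_comp_offDiagMap g hg)
    (RelProjResolution.homPostcomp k M (cornerLinearMap g hg))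
    (LinearMap.ext fun _ => Subtype.ext (MultilinearMap.ext fun _ => rfl))

end

/-- The cohomology of the off-diagonal complex is the relative `Ext`, by dimension shifting in the
coefficients. -/
theorem nonempty_homology_offDiagComplex_equiv (P : BimoduleResolution k A B M) (n : ℕ) :
    ∀ (X : Type v) [AddCommGroup X] [Module k X]
      [Module (TriangularAlgebra A M B) X] [Module (TriangularAlgebra A M B)ᵐᵒᵖ X]
      [IsScalarTower k (TriangularAlgebra A M B) X]
      [IsScalarTower k (TriangularAlgebra A M B)ᵐᵒᵖ X]
      [SMulCommClass (TriangularAlgebra A M B) (TriangularAlgebra A M B)ᵐᵒᵖ X],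
      Nonempty ((offDiagComplex k A M B X).homology (n + 1) ≃ₗ[k]
        (sequenceComplex (P.homD (XAB k A M B X)) (P.homD_comp (XAB k A M B X))).homology n) := by
  induction n with
  | zero =>
    intro X _ _ _ _ _ _ _
    exact ⟨(LinearEquiv.ofBijective homToOffDiagHomology.hom
      homToOffDiagHomology_bijective).symm.trans
        (LinearEquiv.ofBijective _ (P.homToExtZero_bijective (XAB k A M B X)))⟩
  | succ n ih =>
    intro X _ _ _ _ _ _ _
    have hι := CoinducedBimodule.isBimoduleMap_unit (k := k) (C := E) (X := X)
    have hp := Cosyzygy.isBimoduleMap_proj (k := k) (C := E) (X := X)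
    have hinj := CoinducedBimodule.unit_injective (k := k) (C := E) (X := X)
    have hex := Cosyzygy.exact_unit_proj (k := k) (C := E) (X := X)
    obtain ⟨s, hs⟩ := Cosyzygy.exists_section k E X
    have hS := offDiagShortComplex_shortExact _ hι _ hp hinj hex s hs
    have hinj' : Function.Injective (cornerLinearMap _ hι) := cornerMap_injective _ _ _ hι hinj
    have hex' : Function.Exact (cornerLinearMap _ hι) (cornerLinearMap _ hp) :=
      cornerMap_exact _ _ _ hι _ hp hex
    have hT := P.homShortComplex_shortExact _ _ hinj' hex' _ (cornerMap_section _ _ _ hp s hs)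
    -- The first shift is separate: Hom(M, I_AB) need not vanish, so both sides are identified with
    -- the cokernel of Hom(M, I_AB) → Hom(M, Z_AB), where Z is the cosyzygy.
    rcases n with _ | n
    · obtain ⟨e₁⟩ := hS.nonempty_quotient_range_equiv 1 2 rfl
        (isZero_homology_offDiagComplex_coinduced X 0) _ _ homToOffDiagHomology_bijective
        homToOffDiagHomology_bijective _ (homToOffDiagHomology_comp_homologyMap _ hι _ hp hinj hex)
      obtain ⟨e₂⟩ := hT.nonempty_quotient_range_equiv 0 1 rfl
        (isZero_homology_homD_coinduced X P 0) _ _ (P.homToExtZero_bijective _)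
        (P.homToExtZero_bijective _) _ (P.homToExtZero_comp_homologyMap _ _ hinj' hex')
      exact ⟨e₁.symm.trans e₂⟩
    -- From here on the coinduced term is acyclic in both adjacent degrees, so the connecting maps
    -- are isomorphisms on each side. The induction hypothesis is needed for the cosyzygy, not for
    -- `X`, hence the quantification over coefficients.
    · obtain ⟨e⟩ := ih (Cosyzygy k E X)
      have e₁ := hS.δIso (n + 2) (n + 3) rfl (isZero_homology_offDiagComplex_coinduced X n)
        (isZero_homology_offDiagComplex_coinduced X (n + 1))
      have e₂ := hT.δIso (n + 1) (n + 2) rfl (isZero_homology_homD_coinduced X P n)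
        (isZero_homology_homD_coinduced X P (n + 1))
      exact ⟨e₁.toLinearEquiv.symm.trans (e.trans e₂.toLinearEquiv)⟩

end TriangularAlgebra

/-! ### The long exact sequence -/

theorem theorem1 {k : Type u} [CommRing k]
    {A B M : Type v} [Ring A] [Algebra k A] [Ring B] [Algebra k B]
    [AddCommGroup M] [Module k M] [Module A M] [Module Bᵐᵒᵖ M]
    [IsScalarTower k A M] [IsScalarTower k Bᵐᵒᵖ M] [SMulCommClass A Bᵐᵒᵖ M]
    {X : Type v} [AddCommGroup X] [Module k X]
    [Module (TriangularAlgebra A M B) X] [Module (TriangularAlgebra A M B)ᵐᵒᵖ X]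
    [IsScalarTower k (TriangularAlgebra A M B) X]
    [IsScalarTower k (TriangularAlgebra A M B)ᵐᵒᵖ X]
    [SMulCommClass (TriangularAlgebra A M B) (TriangularAlgebra A M B)ᵐᵒᵖ X]
    (P : BimoduleResolution k A B M) :
    ∃ (j : ∀ n : ℕ, hochschildCohomology k (TriangularAlgebra A M B) X n →ₗ[k]
          hochschildCohomology k A (TriangularAlgebra.XAA k A M B X) n ×
            hochschildCohomology k B (TriangularAlgebra.XBB k A M B X) n)
      (δ : ∀ n : ℕ, hochschildCohomology k A (TriangularAlgebra.XAA k A M B X) n ×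
            hochschildCohomology k B (TriangularAlgebra.XBB k A M B X) n →ₗ[k]
          bimoduleExt (TriangularAlgebra.XAB k A M B X) P n)
      (π : ∀ n : ℕ, bimoduleExt (TriangularAlgebra.XAB k A M B X) P n →ₗ[k]
          hochschildCohomology k (TriangularAlgebra A M B) X (n + 1)),
      Function.Injective (j 0) ∧
        ∀ n : ℕ, Function.Exact (j n) (δ n) ∧ Function.Exact (δ n) (π n) ∧
          Function.Exact (π n) (j (n + 1)) := by
  exact (TriangularAlgebra.diagShortComplex_shortExact k A M B X).exists_long_exact_sequence
    (TriangularAlgebra.isZero_homology_offDiagComplex_zero k A M B X)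
    (N₁ := fun n => bimoduleExt (TriangularAlgebra.XAB k A M B X) P n)
    (N₃ := fun n => hochschildCohomology k A (TriangularAlgebra.XAA k A M B X) n ×
      hochschildCohomology k B (TriangularAlgebra.XBB k A M B X) n)
    (fun n => (TriangularAlgebra.nonempty_homology_offDiagComplex_equiv P n X).some)
    (fun n => homologyProdEquiv _ (hochschildD_comp k A _) _ (hochschildD_comp k B _) n)
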